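/- Let $n\ge 1$, let $\Omega\subset\mathbb R^n$ be open, bounded and connected (nonempty), $\mathcal C=\Omega\times(0,\infty)$, $s\in(0,1)$, $\alpha=1-2s$ and $d_s=2^{\alpha}\Gamma(1-s)/\Gamma(s)$. Let $A:\Omega\to\mathbb R^{n\times n}$ be Lipschitz continuous, symmetric and uniformly positive definite, let $0\le c\in L^\infty(\Omega)$, let $\mathsf a,\mathsf b,u_d\in L^2(\Omega)$ with $\mathsf a\le\mathsf b$ a.e. in $\Omega$, and let $\mu>0$. Put $$Z_{ad}=\{q\in L^2(\Omega):\ \mathsf a\le q\le\mathsf b\ \text{a.e. in }\Omega\},\qquad J(v,q)=\tfrac12\|v-u_d\|_{L^2(\Omega)}^2+\tfrac{\mu}{2}\|q\|_{L^2(\Omega)}^2 .$$ Let $H^1(y^\alpha,\mathcal C)$ be the space of all $w\in L^2(y^\alpha,\mathcal C)$ whose distributional gradient belongs to $L^2(y^\alpha,\mathcal C)$, with norm $(\|w\|^2_{L^2(y^\alpha,\mathcal C)}+\|\nabla w\|^2_{L^2(y^\alpha,\mathcal C)})^{1/2}$. Let $\mathring H^1_L(y^\alpha,\mathcal C)$ be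 its subspace of functions with $w=0$ on $\partial\Omega\times[0,\infty)$, in the sense that $w$ is a limit in $H^1(y^\alpha,\mathcal C)$ of functions $\varphi|_{\mathcal C}$ with $\varphi\in C_c^\infty(\Omega\times\mathbb R)$. Let $\operatorname{tr}:\mathring H^1_L(y^\alpha,\mathcal C)\to L^2(\Omega)$ be the trace onto $\Omega\times\{0\}$, that is, the extension by continuity of $\varphi\mapsto\varphi(\cdot,0)$. For $w,\phi\in\mathring H^1_L(y^\alpha,\mathcal C)$ let $$a(w,\phi)=\frac1{d_s}\int_{\mathcal C}y^\alpha\big(\operatorname{diag}\{A(x'),1\}\nabla w\cdot\nabla\phi+c(x')\,w\,\phi\big)\,dx'\,dy .$$ The extended optimal control problem is to minimize $J(\operatorname{tr}\mathscr u,q)$ over all pairs $(\mathscr u,q)\in\mathring H^1_L(y^\alpha,\mathcal C)\times Z_{ad}$ that satisfy the state equation $$a(\mathscr u,\phi)=(q,\operatorname{tr}\phi)_{L^2(\Omega)}\qquad\forall\phi\in\mathring H^1_L(y^\alpha,\mathcal C).\tag{S}$$ Then every $w\in\mathring H^1_L(y^\alpha,\mathcal C)$ has a unique trace in $L^2(\Omega)$;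 for every $q\in L^2(\Omega)$ the state equation (S) has a unique solution; for every $\mathscr u\in\mathring H^1_L(y^\alpha,\mathcal C)$ the adjoint equation $$a(\mathscr p,\phi)=(\operatorname{tr}\mathscr u-u_d,\operatorname{tr}\phi)_{L^2(\Omega)}\qquad\forall\phi\in\mathring H^1_L(y^\alpha,\mathcal C)\tag{P}$$ has a unique solution; and the extended optimal control problem has a unique optimal pair $(\bar{\mathscr u},\bar q)$. Moreover, a pair $(\bar{\mathscr u},\bar q)\in\mathring H^1_L(y^\alpha,\mathcal C)\times L^2(\Omega)$ is optimal if and only if there is $\bar{\mathscr p}\in\mathring H^1_L(y^\alpha,\mathcal C)$ such that $\bar{\mathscr u}$ solves (S) with $q=\bar q$, $\bar{\mathscr p}$ solves (P) with $\mathscr u=\bar{\mathscr u}$, and $$\bar q\in Z_{ad},\qquad(\operatorname{tr}\bar{\mathscr p}+\mu\bar q,\;q-\bar q)_{L^2(\Omega)}\ge0\qquad\forall q\in Z_{ad}.$$ -/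

import Mathlib

open MeasureTheory Filter Topology
open scoped Matrix ENNReal

noncomputable section

namespace ExtendedControl

/-- The space `ℝⁿ` of the variable `x'`, with its Euclidean norm. -/
abbrev Sp (n : ℕ) : Type := EuclideanSpace ℝ (Fin n)

/-- The space `L²(Ω)`. -/
abbrev L2 {n : ℕ} (Ω : Set (Sp n)) : Type := Lp ℝ 2 ((volume : Measure (Sp n)).restrict Ω)

/-- The semi-infinite cylinder `𝒞 = Ω × (0, ∞)` with base `Ω`. -/
def cylinder {n : ℕ} (Ω : Set (Sp n)) : Set (Sp n × ℝ) := Ω ×ˢ Set.Ioi (0 : ℝ)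

/-- The measure `y^α dx' dy` on the cylinder `𝒞`. -/
def weightedMeasure {n : ℕ} (Ω : Set (Sp n)) (α : ℝ) : Measure (Sp n × ℝ) :=
  ((volume : Measure (Sp n × ℝ)).restrict (cylinder Ω)).withDensity
    (fun p => ENNReal.ofReal (p.2 ^ α))

/-- The classical gradient `∇_{x'} φ` in the first `n` variables. -/
def gradX {n : ℕ} (φ : Sp n × ℝ → ℝ) (p : Sp n × ℝ) : Sp n :=
  gradient (fun x => φ (x, p.2)) p.1

/-- The classical partial derivative `∂_y φ` in the extended variable. -/
def derivY {n : ℕ} (φ : Sp n × ℝ → ℝ) (p : Sp n × ℝ) : ℝ :=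
  deriv (fun y => φ (p.1, y)) p.2

/-- Infinitely differentiable functions on `ℝⁿ × ℝ` whose support is compact and contained in
`U`. -/
structure IsTestFunction {n : ℕ} (U : Set (Sp n × ℝ)) (φ : Sp n × ℝ → ℝ) : Prop where
  contDiff : ContDiff ℝ ((⊤ : ℕ∞) : WithTop ℕ∞) φ
  hasCompactSupport : HasCompactSupport φ
  tsupport_subset : tsupport φ ⊆ U

/-- The weighted Sobolev space `H¹(y^α, 𝒞)`: a function `val` in `L²(y^α, 𝒞)` whose distributional
gradient `∇ val = (gradX, gradY)` on the open set `𝒞` belongs to `L²(y^α, 𝒞)`. The gradient is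
determined by `val`, it is carried along so that it can be referred to. -/
@[ext]
structure WeightedH1 {n : ℕ} (Ω : Set (Sp n)) (α : ℝ) where
  val : Lp ℝ 2 (weightedMeasure Ω α)
  gradX : Lp (Sp n) 2 (weightedMeasure Ω α)
  gradY : Lp ℝ 2 (weightedMeasure Ω α)
  weak_gradX : ∀ ψ : Sp n × ℝ → ℝ, IsTestFunction (cylinder Ω) ψ →
    ∫ p in cylinder Ω, val p • ExtendedControl.gradX ψ p
      = - ∫ p in cylinder Ω, ψ p • gradX p
  weak_gradY : ∀ ψ : Sp n × ℝ → ℝ, IsTestFunction (cylinder Ω) ψ →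
    ∫ p in cylinder Ω, val p * derivY ψ p = - ∫ p in cylinder Ω, ψ p * gradY p

/-- Convergence `φ k → w` in the norm of `H¹(y^α, 𝒞)`, for smooth functions `φ k`. -/
def TendstoH1 {n : ℕ} {Ω : Set (Sp n)} {α : ℝ} (φ : ℕ → Sp n × ℝ → ℝ)
    (w : WeightedH1 Ω α) : Prop :=
  Tendsto (fun k => eLpNorm (fun p => φ k p - w.val p) 2 (weightedMeasure Ω α)) atTop (𝓝 0) ∧
  Tendsto (fun k => eLpNorm (fun p => gradX (φ k) p - w.gradX p) 2 (weightedMeasure Ω α))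
    atTop (𝓝 0) ∧
  Tendsto (fun k => eLpNorm (fun p => derivY (φ k) p - w.gradY p) 2 (weightedMeasure Ω α))
    atTop (𝓝 0)

/-- The boundary condition `w = 0` on the lateral boundary `∂Ω × [0, ∞)`: `w` is a limit in
`H¹(y^α, 𝒞)` of smooth functions whose support is a compact subset of `Ω × ℝ`. (These functions
vanish near the lateral boundary, but not necessarily near `Ω × {0}`.) -/
def WeightedH1.VanishesLaterally {n : ℕ} {Ω : Set (Sp n)} {α : ℝ} (w : WeightedH1 Ω α) : Prop :=
  ∃ φ : ℕ → Sp n × ℝ → ℝ, (∀ k, IsTestFunction (Ω ×ˢ Set.univ) (φ k)) ∧ TendstoH1 φ w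

/-- The space `H̊¹_L(y^α, 𝒞)` of the functions of `H¹(y^α, 𝒞)` that vanish on the lateral
boundary. -/
abbrev HL {n : ℕ} (Ω : Set (Sp n)) (α : ℝ) : Type :=
  {w : WeightedH1 Ω α // w.VanishesLaterally}

/-- `u ∈ L²(Ω)` is the trace of `w` onto `Ω × {0}`: the extension by continuity of the restriction
`φ ↦ φ(·, 0)` of smooth functions. -/
def IsTrace {n : ℕ} {Ω : Set (Sp n)} {α : ℝ} (w : HL Ω α) (u : L2 Ω) : Prop :=
  ∃ φ : ℕ → Sp n × ℝ → ℝ, (∀ k, IsTestFunction (Ω ×ˢ Set.univ) (φ k)) ∧ TendstoH1 φ w.1 ∧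
    Tendsto (fun k => eLpNorm (fun x => φ k (x, 0) - u x) 2 (volume.restrict Ω)) atTop (𝓝 0)

/-- The trace operator `tr` (that every `w` has exactly one trace is part of the theorem). -/
def tr {n : ℕ} {Ω : Set (Sp n)} {α : ℝ} (w : HL Ω α) : L2 Ω :=
  Classical.epsilon (fun u => IsTrace w u)

/-- The constant `d_s = 2^α Γ(1 - s) / Γ(s)` with `α = 1 - 2s`. -/
def dConst (s : ℝ) : ℝ := (2 : ℝ) ^ (1 - 2 * s) * Real.Gamma (1 - s) / Real.Gamma s

/-- The bilinear form
`a(w, φ) = d_s⁻¹ ∫_𝒞 y^α (diag(A, 1) ∇w · ∇φ + c w φ)` with `α = 1 - 2s`. -/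
def form {n : ℕ} (Ω : Set (Sp n)) (s : ℝ) (A : Sp n → Matrix (Fin n) (Fin n) ℝ) (c : Sp n → ℝ)
    (w φ : HL Ω (1 - 2 * s)) : ℝ :=
  (1 / dConst s) * ∫ p,
    ((A p.1 *ᵥ (w.1.gradX p).ofLp) ⬝ᵥ (φ.1.gradX p).ofLp + w.1.gradY p * φ.1.gradY p
      + c p.1 * w.1.val p * φ.1.val p) ∂(weightedMeasure Ω (1 - 2 * s))

/-- The set `Z_ad` of admissible controls. -/
def admissible {n : ℕ} {Ω : Set (Sp n)} (a b : L2 Ω) : Set (L2 Ω) :=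
  {q | ∀ᵐ x ∂((volume : Measure (Sp n)).restrict Ω), a x ≤ q x ∧ q x ≤ b x}

/-- The cost functional `J(v, q) = ½ ‖v - u_d‖² + (μ/2) ‖q‖²` with the norms of `L²(Ω)`. -/
def cost {n : ℕ} {Ω : Set (Sp n)} (ud : L2 Ω) (μ : ℝ) (v q : L2 Ω) : ℝ :=
  (1 / 2) * ‖v - ud‖ ^ 2 + (μ / 2) * ‖q‖ ^ 2

/-- The state equation: `u` is the weak solution with control `q`. -/
def IsState {n : ℕ} {Ω : Set (Sp n)} (s : ℝ) (A : Sp n → Matrix (Fin n) (Fin n) ℝ)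
    (c : Sp n → ℝ) (q : L2 Ω) (u : HL Ω (1 - 2 * s)) : Prop :=
  ∀ φ : HL Ω (1 - 2 * s), form Ω s A c u φ = inner ℝ q (tr φ)

/-- The adjoint equation: `p` is the adjoint state associated with the state `u`. -/
def IsAdjointState {n : ℕ} {Ω : Set (Sp n)} (s : ℝ) (A : Sp n → Matrix (Fin n) (Fin n) ℝ)
    (c : Sp n → ℝ) (ud : L2 Ω) (u p : HL Ω (1 - 2 * s)) : Prop :=
  ∀ φ : HL Ω (1 - 2 * s), form Ω s A c p φ = inner ℝ (tr u - ud) (tr φ)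

/-- Optimal pairs of the extended optimal control problem: minimize `J(tr u, q)` subject to the
state equation and `q ∈ Z_ad`. -/
def IsOptimalPair {n : ℕ} {Ω : Set (Sp n)} (s : ℝ) (A : Sp n → Matrix (Fin n) (Fin n) ℝ)
    (c : Sp n → ℝ) (a b ud : L2 Ω) (μ : ℝ) (u : HL Ω (1 - 2 * s)) (q : L2 Ω) : Prop :=
  q ∈ admissible a b ∧ IsState s A c q u ∧
    ∀ (u' : HL Ω (1 - 2 * s)) (q' : L2 Ω), q' ∈ admissible a b → IsState s A c q' u' →
      cost ud μ (tr u) q ≤ cost ud μ (tr u') q'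

end ExtendedControl

end

open ExtendedControl

/-! The triples `(φ, ∇_{x'} φ, ∂_y φ)` of test functions supported in `Ω × ℝ` span a subspace of a
product of weighted `L²` spaces. Its closure, `Energy`, is a Hilbert space. Weak derivatives are
closed under `L²` limits (`exists_toAmbient_eq`), so this closure is exactly `H̊¹_L(y^α, 𝒞)`.

Two inequalities for test functions pass to the closure. The trace inequality `integral_trace_sq_le`
makes the restriction to `y = 0` bounded. The Poincaré inequality `integral_sq_le_integral_gradX_sq`
in the `x'` variable makes the form coercive (`exists_coercive_form`).

What remains is a Hilbert space problem (`linearQuadratic_control`). Lax–Milgram gives a bounded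
solution operator `S`, and the control-to-trace map `R = tr ∘ S` is self-adjoint because the form is
symmetric. Twice the reduced cost is the squared distance from `(u_d, 0)` to `(R q, √μ q)`. The
optimal control is therefore obtained by projection onto a complete convex set, and the projection
theorem yields both its existence and the variational inequality. Self-adjointness of `R` identifies
the gradient of the reduced cost as `tr p + μ q`, with `p` the adjoint state. -/

namespace ExtendedControl

/-! ### Linear-quadratic control problems in Hilbert spaces -/

section Abstract

variable {V U : Type*} [NormedAddCommGroup V] [InnerProductSpace ℝ V] [CompleteSpace V]
  [NormedAddCommGroup U] [InnerProductSpace ℝ U]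

/-- The solution operator of a coercive variational problem whose data act through `T`. -/
theorem exists_solutionOperator [CompleteSpace U] {B : V →L[ℝ] V →L[ℝ] ℝ}
    (hB : IsCoercive B) (T : V →L[ℝ] U) :
    ∃ S : U →L[ℝ] V, ∀ (q : U) (u : V), (∀ φ, B u φ = inner ℝ q (T φ)) ↔ u = S q := by
  -- The functional `φ ↦ ⟪q, T φ⟫` is represented by `T* q`, so `S` is the inverse of the
  -- Lax–Milgram operator composed with `T*`.
  refine ⟨(hB.continuousLinearEquivOfBilin.symm : V →L[ℝ] V) ∘L
    ContinuousLinearMap.adjoint T, fun q u => ?_⟩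
  have h : ∀ φ, inner ℝ q (T φ) = inner ℝ (ContinuousLinearMap.adjoint T q) φ := fun φ =>
    (ContinuousLinearMap.adjoint_inner_left T φ q).symm
  simp only [ContinuousLinearMap.comp_apply, ContinuousLinearEquiv.coe_coe, h]
  rw [ContinuousLinearEquiv.eq_symm_apply]
  constructor
  · intro H
    exact (hB.unique_continuousLinearEquivOfBilin fun φ => (H φ).symm).symm
  · intro H φ
    rw [← H, hB.continuousLinearEquivOfBilin_apply]

/-- The minimizers over a closed convex set of the distance to a point. -/
theorem norm_sub_le_iff_inner_nonpos {K : Set U} (hK : Convex ℝ K) {t v : U} (hv : v ∈ K) :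
    (∀ w ∈ K, ‖t - v‖ ≤ ‖t - w‖) ↔ ∀ w ∈ K, inner ℝ (t - v) (w - v) ≤ 0 := by
  rw [← norm_eq_iInf_iff_real_inner_le_zero hK hv]
  have hbdd : BddBelow (Set.range fun w : K => ‖t - w‖) :=
    ⟨0, Set.forall_mem_range.2 fun _ => norm_nonneg _⟩
  have : Nonempty K := ⟨⟨v, hv⟩⟩
  constructor
  · intro h
    exact le_antisymm (le_ciInf fun w => h w w.2) (ciInf_le hbdd ⟨v, hv⟩)
  · intro h w hw
    rw [h]
    exact ciInf_le hbdd ⟨w, hw⟩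

/-- The point `(R q, √μ q)`, whose distance to `(u_d, 0)` measures the cost of `q`. -/
noncomputable def costPoint (R : U →L[ℝ] U) (μ : ℝ) : U →ₗ[ℝ] WithLp 2 (U × U) where
  toFun q := WithLp.toLp 2 (R q, Real.sqrt μ • q)
  map_add' p q := by rw [← WithLp.toLp_add]; simp
  map_smul' r q := by
    rw [← WithLp.toLp_smul]
    simp [smul_comm r]

theorem norm_sq_sub_costPoint (R : U →L[ℝ] U) {μ : ℝ} (hμ : 0 ≤ μ) (ud q : U) :
    ‖WithLp.toLp 2 (ud, 0) - costPoint R μ q‖ ^ 2 = ‖R q - ud‖ ^ 2 + μ * ‖q‖ ^ 2 := by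
  rw [WithLp.prod_norm_sq_eq_of_L2]
  simp [costPoint, norm_smul, mul_pow, Real.sq_sqrt hμ, norm_sub_rev ud]

/-- Up to sign this is the derivative of the reduced cost at `q` in the direction `q' - q`. The
angle condition of the projection theorem thereby becomes the variational inequality. -/
theorem inner_sub_costPoint (R : U →L[ℝ] U) {μ : ℝ} (hμ : 0 ≤ μ) (ud q q' : U) :
    inner ℝ (WithLp.toLp 2 (ud, 0) - costPoint R μ q) (costPoint R μ q' - costPoint R μ q) =
      -(inner ℝ (R q - ud) (R (q' - q)) + μ * inner ℝ q (q' - q)) := by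
  rw [← map_sub, WithLp.prod_inner_apply]
  change inner ℝ (ud - R q) (R (q' - q)) + inner ℝ (0 - √μ • q) (√μ • (q' - q)) = _
  simp only [zero_sub, inner_neg_left, real_inner_smul_left, real_inner_smul_right,
    ← mul_assoc, Real.mul_self_sqrt hμ]
  rw [← neg_sub (R q), inner_neg_left]
  ring

/-- First order characterization of the minimizers of a regularized quadratic cost. -/
theorem isMin_iff_variationalInequality (R : U →L[ℝ] U) {μ : ℝ} (hμ : 0 < μ) (ud : U) {Z : Set U}
    (hZ : Convex ℝ Z) {q : U} (hq : q ∈ Z) :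
    (∀ q' ∈ Z, (1 / 2) * ‖R q - ud‖ ^ 2 + (μ / 2) * ‖q‖ ^ 2 ≤
      (1 / 2) * ‖R q' - ud‖ ^ 2 + (μ / 2) * ‖q'‖ ^ 2) ↔
    ∀ q' ∈ Z, 0 ≤ inner ℝ (R q - ud) (R (q' - q)) + μ * inner ℝ q (q' - q) := by
  have h := norm_sub_le_iff_inner_nonpos (hZ.linear_image (costPoint R μ))
    (t := WithLp.toLp 2 (ud, 0)) (Set.mem_image_of_mem _ hq)
  simp only [Set.forall_mem_image, inner_sub_costPoint R hμ.le, neg_nonpos] at h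
  rw [← h]
  refine forall₂_congr fun q' _ => ?_
  rw [← sq_le_sq₀ (norm_nonneg _) (norm_nonneg _), norm_sq_sub_costPoint R hμ.le,
    norm_sq_sub_costPoint R hμ.le]
  constructor <;> intro h <;> linarith

/-- Existence is projection onto the image of `Z` under `costPoint`, which is complete because `μ >
0` bounds `costPoint` from below. Uniqueness comes from adding the variational inequalities of two
minimizers. -/
theorem existsUnique_isMin [CompleteSpace U] (R : U →L[ℝ] U) {μ : ℝ} (hμ : 0 < μ) (ud : U) {Z : Set U}
    (hZ : Convex ℝ Z) (hZc : IsClosed Z) (hZn : Z.Nonempty) :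
    ∃! q, q ∈ Z ∧ ∀ q' ∈ Z, (1 / 2) * ‖R q - ud‖ ^ 2 + (μ / 2) * ‖q‖ ^ 2 ≤
      (1 / 2) * ‖R q' - ud‖ ^ 2 + (μ / 2) * ‖q'‖ ^ 2 := by
  have hcont : Continuous (costPoint R μ) :=
    (WithLp.prod_continuous_toLp 2 U U).comp (R.continuous.prodMk (continuous_const_smul _))
  -- The second component alone gives `‖costPoint R μ q‖ ≥ √μ ‖q‖`.
  have hanti : AntilipschitzWith (Real.toNNReal (Real.sqrt μ)⁻¹) (costPoint R μ) := by
    refine AddMonoidHomClass.antilipschitz_of_bound _ fun q => ?_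
    have hs : 0 < Real.sqrt μ := Real.sqrt_pos.2 hμ
    rw [Real.coe_toNNReal _ (inv_nonneg.2 hs.le), inv_mul_eq_div, le_div_iff₀ hs]
    have h2 : ‖costPoint R μ q‖ ^ 2 = ‖R q‖ ^ 2 + μ * ‖q‖ ^ 2 := by
      rw [WithLp.prod_norm_sq_eq_of_L2]
      simp [costPoint, norm_smul, mul_pow, Real.sq_sqrt hμ.le]
    refine abs_le_of_sq_le_sq' ?_ (norm_nonneg _) |>.2
    rw [h2, mul_pow, Real.sq_sqrt hμ.le]
    nlinarith [sq_nonneg ‖R q‖]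
  have hcomp : IsComplete (costPoint R μ '' Z) := by
    have hlip : UniformContinuous (costPoint R μ) :=
      (⟨costPoint R μ, hcont⟩ : U →L[ℝ] WithLp 2 (U × U)).uniformContinuous
    exact (hanti.isUniformInducing hlip).isComplete_iff.2 hZc.isComplete
  obtain ⟨_, ⟨q, hq, rfl⟩, hmin⟩ := exists_norm_eq_iInf_of_complete_convex (hZn.image _) hcomp
    (hZ.linear_image (costPoint R μ)) (WithLp.toLp 2 (ud, 0))
  have hex : ∀ q' ∈ Z, (1 / 2) * ‖R q - ud‖ ^ 2 + (μ / 2) * ‖q‖ ^ 2 ≤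
      (1 / 2) * ‖R q' - ud‖ ^ 2 + (μ / 2) * ‖q'‖ ^ 2 := by
    rw [isMin_iff_variationalInequality R hμ ud hZ hq]
    have := (norm_eq_iInf_iff_real_inner_le_zero (hZ.linear_image (costPoint R μ))
      (Set.mem_image_of_mem _ hq)).1 hmin
    simpa only [Set.forall_mem_image, inner_sub_costPoint R hμ.le, neg_nonpos] using this
  refine ⟨q, ⟨hq, hex⟩, fun r ⟨hr, hrmin⟩ => ?_⟩
  rw [isMin_iff_variationalInequality R hμ ud hZ hq] at hex
  rw [isMin_iff_variationalInequality R hμ ud hZ hr] at hrmin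
  have h1 := hex r hr
  have h2 := hrmin q hq
  -- Each minimizer is tested against the other. The sum is nonnegative, yet equals minus a sum of
  -- squares.
  have h3 : (inner ℝ (R q - ud) (R (r - q)) + μ * inner ℝ q (r - q)) +
      (inner ℝ (R r - ud) (R (q - r)) + μ * inner ℝ r (q - r)) =
      -(‖R (r - q)‖ ^ 2 + μ * ‖r - q‖ ^ 2) := by
    rw [← real_inner_self_eq_norm_sq, ← real_inner_self_eq_norm_sq]
    simp only [map_sub, inner_sub_left, inner_sub_right]
    ring
  have h4 : μ * ‖r - q‖ ^ 2 ≤ 0 := by nlinarith [sq_nonneg ‖R (r - q)‖]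
  have h5 : ‖r - q‖ ^ 2 ≤ 0 := by nlinarith [sq_nonneg ‖r - q‖]
  exact sub_eq_zero.1 (norm_eq_zero.1 (pow_eq_zero_iff two_ne_zero |>.1
    (le_antisymm h5 (sq_nonneg _))))

/-- Well-posedness and optimality system of a linear-quadratic control problem whose state space
is identified with a Hilbert space. -/
theorem linearQuadratic_control [CompleteSpace U] {W : Type*} (e : W ≃ V)
    {B : V →L[ℝ] V →L[ℝ] ℝ} (hBc : IsCoercive B) (hBs : ∀ x y, B x y = B y x) (T : V →L[ℝ] U)
    {τ : W → U} (hτ : ∀ w, τ w = T (e w)) {β : W → W → ℝ} (hβ : ∀ w φ, β w φ = B (e w) (e φ))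
    {Z : Set U} (hZ : Convex ℝ Z) (hZc : IsClosed Z) (hZn : Z.Nonempty) (ud : U) {μ : ℝ}
    (hμ : 0 < μ) :
    (∀ q : U, ∃! u : W, ∀ φ, β u φ = inner ℝ q (τ φ)) ∧
    (∀ u : W, ∃! p : W, ∀ φ, β p φ = inner ℝ (τ u - ud) (τ φ)) ∧
    (∃! z : W × U, z.2 ∈ Z ∧ (∀ φ, β z.1 φ = inner ℝ z.2 (τ φ)) ∧
      ∀ (u' : W) (q' : U), q' ∈ Z → (∀ φ, β u' φ = inner ℝ q' (τ φ)) →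
        (1 / 2) * ‖τ z.1 - ud‖ ^ 2 + (μ / 2) * ‖z.2‖ ^ 2 ≤
          (1 / 2) * ‖τ u' - ud‖ ^ 2 + (μ / 2) * ‖q'‖ ^ 2) ∧
    (∀ (u : W) (q : U), (q ∈ Z ∧ (∀ φ, β u φ = inner ℝ q (τ φ)) ∧
      ∀ (u' : W) (q' : U), q' ∈ Z → (∀ φ, β u' φ = inner ℝ q' (τ φ)) →
        (1 / 2) * ‖τ u - ud‖ ^ 2 + (μ / 2) * ‖q‖ ^ 2 ≤
          (1 / 2) * ‖τ u' - ud‖ ^ 2 + (μ / 2) * ‖q'‖ ^ 2) ↔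
      ∃ p : W, (∀ φ, β u φ = inner ℝ q (τ φ)) ∧
        (∀ φ, β p φ = inner ℝ (τ u - ud) (τ φ)) ∧
        q ∈ Z ∧ ∀ q' ∈ Z, 0 ≤ inner ℝ (τ p + μ • q) (q' - q)) := by
  obtain ⟨S, hS⟩ := exists_solutionOperator hBc T
  have hSB : ∀ q φ, B (S q) φ = inner ℝ q (T φ) := fun q => (hS q (S q)).2 rfl
  have hsol : ∀ (f : U) (u : W), (∀ φ, β u φ = inner ℝ f (τ φ)) ↔ u = e.symm (S f) := by
    intro f u
    rw [Equiv.eq_symm_apply, ← hS f (e u), ← e.forall_congr_right]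
    simp only [hβ, hτ]
  let R : U →L[ℝ] U := T ∘L S
  have hτS : ∀ q, τ (e.symm (S q)) = R q := fun q => by rw [hτ, e.apply_symm_apply]; rfl
  have hopt : ∀ u q, (q ∈ Z ∧ u = e.symm (S q) ∧
      ∀ (u' : W) (q' : U), q' ∈ Z → u' = e.symm (S q') →
        (1 / 2) * ‖τ u - ud‖ ^ 2 + (μ / 2) * ‖q‖ ^ 2 ≤
          (1 / 2) * ‖τ u' - ud‖ ^ 2 + (μ / 2) * ‖q'‖ ^ 2) ↔
      q ∈ Z ∧ u = e.symm (S q) ∧ ∀ q' ∈ Z, (1 / 2) * ‖R q - ud‖ ^ 2 + (μ / 2) * ‖q‖ ^ 2 ≤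
        (1 / 2) * ‖R q' - ud‖ ^ 2 + (μ / 2) * ‖q'‖ ^ 2 := by
    intro u q
    refine and_congr_right fun _ => and_congr_right fun hu => ?_
    subst hu
    constructor
    · intro h q' hq'
      have := h _ q' hq' rfl
      rwa [hτS, hτS] at this
    · rintro h _ q' hq' rfl
      rw [hτS, hτS]
      exact h q' hq'
  -- Symmetry of `B` makes `R = T ∘ S` self-adjoint. Here `S (R q - ud)` is the adjoint state, so
  -- its trace is the gradient of the tracking term.
  have hgrad : ∀ q d : U, inner ℝ (R q - ud) (R d) = inner ℝ (R (R q - ud)) d := by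
    intro q d
    change inner ℝ (R q - ud) (T (S d)) = inner ℝ (T (S (R q - ud))) d
    rw [← hSB, hBs, hSB, real_inner_comm]
  simp only [hsol, hopt]
  refine ⟨fun q => ⟨_, rfl, fun u hu => hu⟩, fun u => ⟨_, rfl, fun p hp => hp⟩, ?_, fun u q => ?_⟩
  · obtain ⟨q, ⟨hq, hmin⟩, huniq⟩ := existsUnique_isMin R hμ ud hZ hZc hZn
    refine ⟨(e.symm (S q), q), ⟨hq, rfl, hmin⟩, ?_⟩
    rintro ⟨u, r⟩ ⟨hr, hu, hrmin⟩
    obtain rfl := huniq r ⟨hr, hrmin⟩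
    exact Prod.ext hu rfl
  · constructor
    · rintro ⟨hq, rfl, hmin⟩
      refine ⟨_, rfl, rfl, hq, fun q' hq' => ?_⟩
      have h := (isMin_iff_variationalInequality R hμ ud hZ hq).1 hmin q' hq'
      rwa [hτS, hτS, inner_add_left, real_inner_smul_left, ← hgrad]
    · rintro ⟨p, rfl, rfl, hq, hvi⟩
      refine ⟨hq, rfl, (isMin_iff_variationalInequality R hμ ud hZ hq).2 fun q' hq' => ?_⟩
      have h := hvi q' hq'
      rwa [hτS, hτS, inner_add_left, real_inner_smul_left, ← hgrad] at h

end Abstract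

/-! ### The weighted measure -/

/-- The measure `y^α dy` on `(0, ∞)`. -/
noncomputable def weight (α : ℝ) : Measure ℝ :=
  (volume.restrict (Set.Ioi (0 : ℝ))).withDensity fun y => ENNReal.ofReal (y ^ α)

instance (α : ℝ) : SFinite (weight α) := by
  unfold weight; infer_instance

/-- The product form permits slicing: at fixed `y` for the Poincaré inequality, at fixed `x'` for
the trace inequality. -/
theorem weightedMeasure_eq_prod {n : ℕ} (Ω : Set (Sp n)) (α : ℝ) :
    weightedMeasure Ω α = (volume.restrict Ω).prod (weight α) := by
  have hm : Measurable fun y : ℝ => ENNReal.ofReal (y ^ α) := by fun_prop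
  rw [weight, prod_withDensity_right hm, Measure.prod_restrict, weightedMeasure, cylinder]
  rfl

/-- Since `α > -1`, the weight is integrable near `0`. Hence test functions that do not vanish near
`y = 0` still lie in the weighted `L²` space. -/
theorem isFiniteMeasureOnCompacts_weight {α : ℝ} (hα : -1 < α) :
    IsFiniteMeasureOnCompacts (weight α) := by
  refine ⟨fun K hK => ?_⟩
  obtain ⟨R, hR⟩ := hK.bddAbove
  have hsub : K ⊆ Set.Iic (max R 1) := fun y hy => (hR hy).trans (le_max_left _ _)
  refine (measure_mono hsub).trans_lt ?_
  rw [weight, withDensity_apply _ measurableSet_Iic, Measure.restrict_restrict measurableSet_Iic,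
    Set.inter_comm, Set.Ioi_inter_Iic]
  have hint : IntegrableOn (fun y : ℝ => y ^ α) (Set.Ioc 0 (max R 1)) :=
    (intervalIntegrable_iff_integrableOn_Ioc_of_le (by positivity)).1
      (intervalIntegral.intervalIntegrable_rpow' hα)
  exact hint.lintegral_lt_top

theorem isFiniteMeasureOnCompacts_weightedMeasure {n : ℕ} (Ω : Set (Sp n)) {α : ℝ}
    (hα : -1 < α) : IsFiniteMeasureOnCompacts (weightedMeasure Ω α) := by
  have := isFiniteMeasureOnCompacts_weight hα
  rw [weightedMeasure_eq_prod]
  infer_instance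

theorem quasiMeasurePreserving_fst {n : ℕ} (Ω : Set (Sp n)) (α : ℝ) :
    Measure.QuasiMeasurePreserving Prod.fst (weightedMeasure Ω α) (volume.restrict Ω) := by
  rw [weightedMeasure_eq_prod]
  exact Measure.quasiMeasurePreserving_fst

theorem ae_fst_mem {n : ℕ} {Ω : Set (Sp n)} (hΩ : MeasurableSet Ω) (α : ℝ) :
    ∀ᵐ p ∂(weightedMeasure Ω α), p.1 ∈ Ω :=
  (quasiMeasurePreserving_fst Ω α).ae (ae_restrict_mem hΩ)

/-! ### Derivatives of smooth functions -/

section Smooth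

variable {n : ℕ} {φ ψ : Sp n × ℝ → ℝ}

/-- Reduces the slice gradient to the joint Fréchet derivative, from which continuity, linearity and
support properties are inherited. -/
theorem inner_gradX (hφ : ContDiff ℝ ((⊤ : ℕ∞) : WithTop ℕ∞) φ) (p : Sp n × ℝ) (v : Sp n) :
    inner ℝ (gradX φ p) v = fderiv ℝ φ p (v, 0) := by
  have h1 : HasFDerivAt φ (fderiv ℝ φ p) (p.1, p.2) :=
    (hφ.differentiable (by simp)).differentiableAt.hasFDerivAt
  have h2 : HasFDerivAt (fun x : Sp n => φ (x, p.2))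
      ((fderiv ℝ φ p).comp (ContinuousLinearMap.inl ℝ (Sp n) ℝ)) p.1 :=
    h1.comp p.1 (hasFDerivAt_prodMk_left p.1 p.2)
  rw [gradX, gradient, InnerProductSpace.toDual_symm_apply, h2.fderiv]
  simp

theorem derivY_eq (hφ : ContDiff ℝ ((⊤ : ℕ∞) : WithTop ℕ∞) φ) (p : Sp n × ℝ) :
    derivY φ p = fderiv ℝ φ p (0, 1) := by
  have h1 : HasFDerivAt φ (fderiv ℝ φ p) (p.1, p.2) :=
    (hφ.differentiable (by simp)).differentiableAt.hasFDerivAt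
  have h2 : HasFDerivAt (fun y : ℝ => φ (p.1, y))
      ((fderiv ℝ φ p).comp (ContinuousLinearMap.inr ℝ (Sp n) ℝ)) p.2 :=
    h1.comp p.2 (hasFDerivAt_prodMk_right p.1 p.2)
  rw [derivY, h2.hasDerivAt.deriv]
  simp

theorem gradX_eq_toDual_symm (hφ : ContDiff ℝ ((⊤ : ℕ∞) : WithTop ℕ∞) φ) :
    gradX φ = fun p => (InnerProductSpace.toDual ℝ (Sp n)).symm
      ((fderiv ℝ φ p).comp (ContinuousLinearMap.inl ℝ (Sp n) ℝ)) := by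
  funext p
  refine ext_inner_right ℝ fun v => ?_
  rw [inner_gradX hφ, InnerProductSpace.toDual_symm_apply]
  simp

theorem continuous_gradX (hφ : ContDiff ℝ ((⊤ : ℕ∞) : WithTop ℕ∞) φ) : Continuous (gradX φ) := by
  rw [gradX_eq_toDual_symm hφ]
  have := hφ.continuous_fderiv (by simp)
  fun_prop

theorem continuous_derivY (hφ : ContDiff ℝ ((⊤ : ℕ∞) : WithTop ℕ∞) φ) :
    Continuous (derivY φ) := by
  rw [funext (derivY_eq hφ)]
  have := hφ.continuous_fderiv (by simp)
  fun_prop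

theorem support_gradX_subset (hφ : ContDiff ℝ ((⊤ : ℕ∞) : WithTop ℕ∞) φ) :
    Function.support (gradX φ) ⊆ tsupport φ := by
  intro p hp
  refine support_fderiv_subset ℝ (f := φ) fun h => hp ?_
  simp [gradX_eq_toDual_symm hφ, h]

theorem support_derivY_subset (hφ : ContDiff ℝ ((⊤ : ℕ∞) : WithTop ℕ∞) φ) :
    Function.support (derivY φ) ⊆ tsupport φ := by
  intro p hp
  refine support_fderiv_subset ℝ (f := φ) fun h => hp ?_
  simp [derivY_eq hφ, h]

theorem gradX_add (hφ : ContDiff ℝ ((⊤ : ℕ∞) : WithTop ℕ∞) φ)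
    (hψ : ContDiff ℝ ((⊤ : ℕ∞) : WithTop ℕ∞) ψ) : gradX (φ + ψ) = gradX φ + gradX ψ := by
  funext p
  refine ext_inner_right ℝ fun v => ?_
  rw [inner_gradX (φ := φ + ψ) (hφ.add hψ), Pi.add_apply, inner_add_left, inner_gradX hφ, inner_gradX hψ,
    fderiv_add (hφ.differentiable (by simp)).differentiableAt
    (hψ.differentiable (by simp)).differentiableAt]
  simp

theorem derivY_add (hφ : ContDiff ℝ ((⊤ : ℕ∞) : WithTop ℕ∞) φ)
    (hψ : ContDiff ℝ ((⊤ : ℕ∞) : WithTop ℕ∞) ψ) : derivY (φ + ψ) = derivY φ + derivY ψ := by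
  funext p
  rw [derivY_eq (φ := φ + ψ) (hφ.add hψ), Pi.add_apply, derivY_eq hφ, derivY_eq hψ,
    fderiv_add (hφ.differentiable (by simp)).differentiableAt
    (hψ.differentiable (by simp)).differentiableAt]
  simp

theorem gradX_smul (r : ℝ) (hφ : ContDiff ℝ ((⊤ : ℕ∞) : WithTop ℕ∞) φ) :
    gradX (r • φ) = r • gradX φ := by
  funext p
  refine ext_inner_right ℝ fun v => ?_
  rw [inner_gradX (φ := r • φ) (hφ.const_smul r), Pi.smul_apply, real_inner_smul_left, inner_gradX hφ,
    fderiv_const_smul (hφ.differentiable (by simp)).differentiableAt]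
  simp

theorem derivY_smul (r : ℝ) (hφ : ContDiff ℝ ((⊤ : ℕ∞) : WithTop ℕ∞) φ) :
    derivY (r • φ) = r • derivY φ := by
  funext p
  rw [derivY_eq (φ := r • φ) (hφ.const_smul r), Pi.smul_apply, derivY_eq hφ,
    fderiv_const_smul (hφ.differentiable (by simp)).differentiableAt]
  simp

variable {U : Set (Sp n × ℝ)}

theorem IsTestFunction.hasCompactSupport_gradX (hφ : IsTestFunction U φ) :
    HasCompactSupport (gradX φ) :=
  hφ.hasCompactSupport.mono' (support_gradX_subset hφ.contDiff)

theorem IsTestFunction.hasCompactSupport_derivY (hφ : IsTestFunction U φ) :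
    HasCompactSupport (derivY φ) :=
  hφ.hasCompactSupport.mono' (support_derivY_subset hφ.contDiff)

theorem IsTestFunction.memLp {μ : Measure (Sp n × ℝ)} [IsFiniteMeasureOnCompacts μ]
    (hφ : IsTestFunction U φ) : MemLp φ 2 μ :=
  hφ.contDiff.continuous.memLp_of_hasCompactSupport hφ.hasCompactSupport

theorem IsTestFunction.memLp_gradX {μ : Measure (Sp n × ℝ)} [IsFiniteMeasureOnCompacts μ]
    (hφ : IsTestFunction U φ) : MemLp (gradX φ) 2 μ :=
  (continuous_gradX hφ.contDiff).memLp_of_hasCompactSupport hφ.hasCompactSupport_gradX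

theorem IsTestFunction.memLp_derivY {μ : Measure (Sp n × ℝ)} [IsFiniteMeasureOnCompacts μ]
    (hφ : IsTestFunction U φ) : MemLp (derivY φ) 2 μ :=
  (continuous_derivY hφ.contDiff).memLp_of_hasCompactSupport hφ.hasCompactSupport_derivY

theorem IsTestFunction.continuous_trace (hφ : IsTestFunction U φ) (y : ℝ) :
    Continuous fun x : Sp n => φ (x, y) :=
  hφ.contDiff.continuous.comp (by fun_prop)

theorem IsTestFunction.hasCompactSupport_trace (hφ : IsTestFunction U φ) (y : ℝ) :
    HasCompactSupport fun x : Sp n => φ (x, y) :=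
  HasCompactSupport.intro (hφ.hasCompactSupport.isCompact.image continuous_fst) fun x hx =>
    image_eq_zero_of_notMem_tsupport fun h => hx ⟨(x, y), h, rfl⟩

theorem IsTestFunction.memLp_trace (hφ : IsTestFunction U φ) (Ω : Set (Sp n)) :
    MemLp (fun x : Sp n => φ (x, 0)) 2 (volume.restrict Ω) :=
  (hφ.continuous_trace 0).memLp_of_hasCompactSupport (hφ.hasCompactSupport_trace 0)

/-- The vector space of the test functions with support in `U`. -/
def testFunctions (U : Set (Sp n × ℝ)) : Submodule ℝ (Sp n × ℝ → ℝ) where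
  carrier := {φ | IsTestFunction U φ}
  zero_mem' := ⟨contDiff_const, HasCompactSupport.zero, by simp [tsupport]⟩
  add_mem' {φ ψ} hφ hψ := ⟨hφ.contDiff.add hψ.contDiff,
    hφ.hasCompactSupport.add hψ.hasCompactSupport,
    (tsupport_add φ ψ).trans (Set.union_subset hφ.tsupport_subset hψ.tsupport_subset)⟩
  smul_mem' r φ hφ := ⟨hφ.contDiff.const_smul r, hφ.hasCompactSupport.smul_left (f := fun _ => r),
    (closure_mono (Function.support_const_smul_subset r φ)).trans hφ.tsupport_subset⟩

end Smooth

/-! ### The Poincaré and the trace inequality for smooth functions -/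

/-- Integration by parts against the coordinate `x_i` gives `∫ u² = -2 ∫ x_i u ∂_i u`. As `|x_i| ≤
R` where `u ≠ 0`, Young's inequality bounds the right side by `½ ∫ u² + 2R² ∫ (∂_i u)²`, and the
first term is absorbed. -/
theorem integral_sq_le_integral_fderiv_sq {n : ℕ} {u : Sp n → ℝ} (hu : ContDiff ℝ 1 u)
    (huc : HasCompactSupport u) {R : ℝ} (hR : ∀ x, u x ≠ 0 → ‖x‖ ≤ R) (i : Fin n) :
    ∫ x, u x ^ 2 ≤ 4 * R ^ 2 * ∫ x, fderiv ℝ u x (EuclideanSpace.single i 1) ^ 2 := by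
  set e : Sp n := EuclideanSpace.single i 1 with he
  set g : Sp n →L[ℝ] ℝ := EuclideanSpace.proj i with hg
  have hge : g e = 1 := by simp [hg, he]
  have hud : ∀ x, DifferentiableAt ℝ u x := fun x => (hu.differentiable (by simp)).differentiableAt
  have hcd : Continuous fun x => fderiv ℝ u x e := by
    have := hu.continuous_fderiv (by simp)
    fun_prop
  have hsq : ∀ x, fderiv ℝ (fun x => u x ^ 2) x e = 2 * u x * fderiv ℝ u x e := by
    intro x
    rw [((hud x).hasFDerivAt.pow 2).fderiv]
    simp
  have huz : ∀ x ∉ tsupport u, u x = 0 := fun x hx => image_eq_zero_of_notMem_tsupport hx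
  have hI1 : Integrable fun x => u x ^ 2 := by
    refine (hu.continuous.pow 2).integrable_of_hasCompactSupport ?_
    exact .intro huc.isCompact fun x hx => by simp [huz x hx]
  have hI2 : Integrable fun x => 2 * u x * fderiv ℝ u x e * g x := by
    refine (((continuous_const.mul hu.continuous).mul hcd).mul
      g.continuous).integrable_of_hasCompactSupport ?_
    exact .intro huc.isCompact fun x hx => by simp [huz x hx]
  have hI3 : Integrable fun x => fderiv ℝ u x e ^ 2 := by
    refine (hcd.pow 2).integrable_of_hasCompactSupport ?_
    exact .intro huc.isCompact fun x hx => by simp [fderiv_of_notMem_tsupport ℝ hx]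
  have hI4 : Integrable fun x => u x ^ 2 * g x := by
    refine ((hu.continuous.pow 2).mul g.continuous).integrable_of_hasCompactSupport ?_
    exact .intro huc.isCompact fun x hx => by simp [huz x hx]
  have hparts : ∫ x, u x ^ 2 = - ∫ x, 2 * u x * fderiv ℝ u x e * g x := by
    have h := integral_mul_fderiv_eq_neg_fderiv_mul_of_integrable (𝕜 := ℝ)
      (μ := (volume : Measure (Sp n))) (f := fun x => u x ^ 2) (g := g) (v := e)
      (by simpa only [hsq] using hI2) (by simpa [hge] using hI1) hI4
      (fun x _ => (hud x).pow 2) (fun x _ => g.differentiableAt)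
    simpa [hsq, hge] using h
  have hle : - ∫ x, 2 * u x * fderiv ℝ u x e * g x ≤
      ∫ x, (1 / 2 * u x ^ 2 + 2 * R ^ 2 * fderiv ℝ u x e ^ 2) := by
    rw [← integral_neg]
    refine integral_mono hI2.neg ((hI1.const_mul _).add (hI3.const_mul _)) fun x => ?_
    -- The bound on `‖x‖` is only available where `u` does not vanish; elsewhere the left side is
    -- zero.
    by_cases hx : u x = 0
    · simp only [hx]
      have := sq_nonneg (R * fderiv ℝ u x e)
      nlinarith
    · have hgx : |g x| ≤ R := (by
        simpa [hg] using (PiLp.norm_apply_le x i) : |g x| ≤ ‖x‖).trans (hR x hx)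
      have h2 : g x ^ 2 ≤ R ^ 2 := sq_le_sq' (abs_le.1 hgx).1 (abs_le.1 hgx).2
      change -(2 * u x * fderiv ℝ u x e * g x) ≤ 1 / 2 * u x ^ 2 + 2 * R ^ 2 * fderiv ℝ u x e ^ 2
      nlinarith [sq_nonneg (u x + 2 * (fderiv ℝ u x e * g x)), sq_nonneg (fderiv ℝ u x e),
        mul_le_mul_of_nonneg_right h2 (sq_nonneg (fderiv ℝ u x e))]
  rw [← hparts, integral_add (hI1.const_mul _) (hI3.const_mul _), integral_const_mul,
    integral_const_mul] at hle
  linarith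

/-- The weight depends on `y` only, so the unweighted inequality on each slice can be integrated in
`y`. The condition `1 ≤ n` provides a coordinate direction. -/
theorem integral_sq_le_integral_gradX_sq {n : ℕ} (hn : 1 ≤ n) {Ω : Set (Sp n)} {α : ℝ}
    (hα : -1 < α) {R : ℝ} (hR : ∀ x ∈ Ω, ‖x‖ ≤ R) {φ : Sp n × ℝ → ℝ}
    (hφ : IsTestFunction (Ω ×ˢ Set.univ) φ) :
    ∫ p, φ p ^ 2 ∂(weightedMeasure Ω α) ≤
      4 * R ^ 2 * ∫ p, ‖gradX φ p‖ ^ 2 ∂(weightedMeasure Ω α) := by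
  have := isFiniteMeasureOnCompacts_weightedMeasure Ω hα
  have hI1 : Integrable (fun p => φ p ^ 2) (weightedMeasure Ω α) := hφ.memLp.integrable_sq
  have hI2 : Integrable (fun p => ‖gradX φ p‖ ^ 2) (weightedMeasure Ω α) :=
    hφ.memLp_gradX.norm.integrable_sq
  have hsupp : ∀ p ∈ tsupport φ, p.1 ∈ Ω := fun p hp => (hφ.tsupport_subset hp).1
  rw [weightedMeasure_eq_prod] at hI1 hI2 ⊢
  rw [integral_prod_symm _ hI1, integral_prod_symm _ hI2, ← integral_const_mul]
  refine integral_mono hI1.integral_prod_right (hI2.integral_prod_right.const_mul _) fun y => ?_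
  change ∫ x in Ω, φ (x, y) ^ 2 ≤ 4 * R ^ 2 * ∫ x in Ω, ‖gradX φ (x, y)‖ ^ 2
  rw [setIntegral_eq_integral_of_forall_compl_eq_zero (fun x hx => by
      rw [image_eq_zero_of_notMem_tsupport fun h => hx (hsupp (x, y) h)]; simp),
    setIntegral_eq_integral_of_forall_compl_eq_zero (fun x hx => by
      rw [Function.notMem_support.1 fun h => hx
        (hsupp (x, y) (support_gradX_subset hφ.contDiff h))]; simp)]
  have hcd : ContDiff ℝ ((⊤ : ℕ∞) : WithTop ℕ∞) fun x : Sp n => φ (x, y) :=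
    hφ.contDiff.comp (contDiff_prodMk_left y)
  refine (integral_sq_le_integral_fderiv_sq (hcd.of_le (by simp))
    (hφ.hasCompactSupport_trace y) (R := R) (fun x hx => hR x
      (hsupp (x, y) (subset_tsupport _ hx))) ⟨0, hn⟩).trans ?_
  refine mul_le_mul_of_nonneg_left ?_ (by positivity)
  have hder : ∀ (x v : Sp n), fderiv ℝ (fun x : Sp n => φ (x, y)) x v =
      inner ℝ (gradX φ (x, y)) v := fun x v => by
    rw [gradX, gradient, InnerProductSpace.toDual_symm_apply]
  refine integral_mono_of_nonneg (ae_of_all _ fun x => sq_nonneg _) ?_ (ae_of_all _ fun x => ?_)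
  · have hc : Continuous fun x : Sp n => gradX φ (x, y) :=
      (continuous_gradX hφ.contDiff).comp (by fun_prop)
    refine (hc.norm.pow 2).integrable_of_hasCompactSupport ?_
    refine HasCompactSupport.intro (hφ.hasCompactSupport.isCompact.image continuous_fst)
      fun x hx => ?_
    rw [Pi.pow_apply, Function.notMem_support.1 fun h => hx
        ⟨(x, y), support_gradX_subset hφ.contDiff h, rfl⟩]
    simp
  · simp only [hder]
    have := abs_real_inner_le_norm (gradX φ (x, y)) (EuclideanSpace.single (⟨0, hn⟩ : Fin n) 1)
    rw [PiLp.norm_single, norm_one, mul_one] at this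
    exact sq_le_sq' (abs_le.1 this).1 (abs_le.1 this).2

theorem integral_weight (α : ℝ) (F : ℝ → ℝ) :
    ∫ y, F y ∂(weight α) = ∫ y in Set.Ioi (0 : ℝ), y ^ α * F y := by
  rw [weight, integral_withDensity_eq_integral_toReal_smul (by fun_prop) (by simp)]
  refine setIntegral_congr_fun measurableSet_Ioi fun y hy => ?_
  simp only [ENNReal.toReal_ofReal (Real.rpow_nonneg (le_of_lt hy) α), smul_eq_mul]

/-- Write `-g 0` as the integral over `(0, 1)` of the derivative of `(1 - y) g y`, then apply a
weighted Cauchy–Schwarz estimate with `y^(-α)` and `y^α`. The factor `∫₀¹ y^(-α) = 1 / (1 - α)` is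
finite because `α < 1`. -/
theorem sq_apply_zero_le_integral {α : ℝ} (hα : -1 < α) (hα1 : α < 1) {g : ℝ → ℝ}
    (hg : ContDiff ℝ 1 g) (hgc : HasCompactSupport g) :
    g 0 ^ 2 ≤ 2 / (1 - α) * ∫ y, (g y ^ 2 + deriv g y ^ 2) ∂(weight α) := by
  have := isFiniteMeasureOnCompacts_weight hα
  have hdc : Continuous (deriv g) := hg.continuous_deriv (by simp)
  set f : ℝ → ℝ := fun y => -g y + (1 - y) * deriv g y with hf
  have hfc : Continuous f := by have := hg.continuous; fun_prop
  have hFTC : ∫ y in (0 : ℝ)..1, f y = -g 0 := by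
    have h := intervalIntegral.integral_eq_sub_of_hasDerivAt (a := 0) (b := 1)
      (f := fun y => (1 - y) * g y) (f' := f) (fun y _ => by
        have h1 := ((hasDerivAt_id y).const_sub 1).mul
          (hg.differentiable (by simp)).differentiableAt.hasDerivAt
        exact h1.congr_deriv (by simp [hf])) (hfc.intervalIntegrable _ _)
    rw [h]; simp
  have hint1 : IntervalIntegrable (fun y : ℝ => y ^ (-α)) volume 0 1 :=
    intervalIntegral.intervalIntegrable_rpow' (by linarith)
  have hint2 : ∀ h : ℝ → ℝ, Continuous h →
      IntervalIntegrable (fun y : ℝ => y ^ α * h y) volume 0 1 := fun h hh =>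
    (intervalIntegral.intervalIntegrable_rpow' hα).mul_continuousOn hh.continuousOn
  have hval : ∫ y in (0 : ℝ)..1, y ^ (-α) = 1 / (1 - α) := by
    rw [integral_rpow (Or.inl (by linarith))]
    rw [Real.zero_rpow (by linarith), Real.one_rpow]
    ring_nf
  -- The optimal parameter for Young's inequality: it maximizes `-2 c g(0) - c² / (1 - α)`.
  set c : ℝ := -(1 - α) * g 0 with hc
  have hpos : 0 < 1 - α := by linarith
  have hyoung : ∫ y in (0 : ℝ)..1, 2 * c * f y ≤
      ∫ y in (0 : ℝ)..1, (c ^ 2 * y ^ (-α) + y ^ α * f y ^ 2) := by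
    refine intervalIntegral.integral_mono_on_of_le_Ioo zero_le_one
      ((continuous_const.mul hfc).intervalIntegrable _ _)
      ((hint1.const_mul _).add (hint2 _ (hfc.pow 2))) fun y hy => ?_
    have hy0 : 0 < y ^ α := Real.rpow_pos_of_pos hy.1 α
    rw [Real.rpow_neg hy.1.le]
    have hsq := mul_nonneg (inv_nonneg.2 hy0.le) (sq_nonneg (c - y ^ α * f y))
    have hexp : (y ^ α)⁻¹ * (c - y ^ α * f y) ^ 2 =
        c ^ 2 * (y ^ α)⁻¹ + y ^ α * f y ^ 2 - 2 * c * f y := by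
      field_simp
      ring
    linarith
  rw [intervalIntegral.integral_const_mul, hFTC, intervalIntegral.integral_add
    (hint1.const_mul _) (hint2 (fun y => f y ^ 2) (hfc.pow 2)), intervalIntegral.integral_const_mul, hval] at hyoung
  have hleft : (1 - α) * g 0 ^ 2 ≤ ∫ y in (0 : ℝ)..1, y ^ α * f y ^ 2 := by
    have : 2 * c * -g 0 - c ^ 2 * (1 / (1 - α)) = (1 - α) * g 0 ^ 2 := by
      rw [hc]; field_simp; ring
    linarith
  have hright : ∫ y in (0 : ℝ)..1, y ^ α * f y ^ 2 ≤
      ∫ y in (0 : ℝ)..1, y ^ α * (2 * (g y ^ 2 + deriv g y ^ 2)) := by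
    refine intervalIntegral.integral_mono_on_of_le_Ioo zero_le_one (hint2 _ (hfc.pow 2))
      (hint2 (fun y => 2 * (g y ^ 2 + deriv g y ^ 2))
        (by have := hg.continuous; fun_prop)) fun y hy => ?_
    refine mul_le_mul_of_nonneg_left ?_ (Real.rpow_nonneg hy.1.le α)
    have h1 : ((1 - y) * deriv g y) ^ 2 ≤ deriv g y ^ 2 := by
      rw [mul_pow]
      exact mul_le_of_le_one_left (sq_nonneg _)
        (pow_le_one₀ (by linarith [hy.2]) (by linarith [hy.1]))
    simp only [hf]
    nlinarith [sq_nonneg (g y + (1 - y) * deriv g y)]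
  have hI : Integrable (fun y => g y ^ 2 + deriv g y ^ 2) (weight α) := by
    refine Continuous.integrable_of_hasCompactSupport
      (by have := hg.continuous; fun_prop) ?_
    exact HasCompactSupport.add (hgc.comp_left (g := fun t : ℝ => t ^ 2) (by simp))
      (hgc.deriv.comp_left (g := fun t : ℝ => t ^ 2) (by simp))
  have hIoi : IntegrableOn (fun y : ℝ => y ^ α * (2 * (g y ^ 2 + deriv g y ^ 2)))
      (Set.Ioi 0) := by
    have h := hI.const_mul 2
    rw [weight, integrable_withDensity_iff_integrable_smul' (by fun_prop) (by simp)] at h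
    refine h.congr ?_
    filter_upwards [ae_restrict_mem measurableSet_Ioi] with y hy
    simp [ENNReal.toReal_ofReal (Real.rpow_nonneg (le_of_lt hy) α)]
  have hext : ∫ y in (0 : ℝ)..1, y ^ α * (2 * (g y ^ 2 + deriv g y ^ 2)) ≤
      2 * ∫ y, (g y ^ 2 + deriv g y ^ 2) ∂(weight α) := by
    rw [← integral_const_mul, integral_weight, intervalIntegral.integral_of_le zero_le_one]
    refine setIntegral_mono_set hIoi ?_ (Set.Ioc_subset_Ioi_self.eventuallyLE)
    filter_upwards [ae_restrict_mem measurableSet_Ioi] with y hy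
    have := Real.rpow_nonneg (le_of_lt hy) α
    change 0 ≤ y ^ α * (2 * (g y ^ 2 + deriv g y ^ 2))
    positivity
  rw [div_mul_eq_mul_div, le_div_iff₀ hpos]
  linarith

/-- The one-dimensional bound on each vertical line, integrated over `Ω`; only the `y`-derivative
enters. -/
theorem integral_trace_sq_le {n : ℕ} {Ω : Set (Sp n)} {α : ℝ} (hα : -1 < α) (hα1 : α < 1)
    {U : Set (Sp n × ℝ)} {φ : Sp n × ℝ → ℝ} (hφ : IsTestFunction U φ) :
    ∫ x in Ω, φ (x, 0) ^ 2 ≤ 2 / (1 - α) *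
      (∫ p, φ p ^ 2 ∂(weightedMeasure Ω α) + ∫ p, derivY φ p ^ 2 ∂(weightedMeasure Ω α)) := by
  have := isFiniteMeasureOnCompacts_weightedMeasure Ω hα
  have hI1 : Integrable (fun p => φ p ^ 2) (weightedMeasure Ω α) := hφ.memLp.integrable_sq
  have hI2 : Integrable (fun p => derivY φ p ^ 2) (weightedMeasure Ω α) :=
    hφ.memLp_derivY.integrable_sq
  have hI := hI1.add hI2
  rw [← integral_add hI1 hI2]
  rw [weightedMeasure_eq_prod] at hI ⊢
  simp only [Pi.add_def] at hI
  rw [integral_prod _ hI, ← integral_const_mul]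
  refine integral_mono (hφ.memLp_trace Ω).integrable_sq (hI.integral_prod_left.const_mul _)
    fun x => ?_
  refine sq_apply_zero_le_integral hα hα1 (g := fun y => φ (x, y))
    ((hφ.contDiff.comp (contDiff_prodMk_right x)).of_le (by simp)) ?_
  exact HasCompactSupport.intro (hφ.hasCompactSupport.isCompact.image continuous_snd) fun y hy =>
    image_eq_zero_of_notMem_tsupport fun h => hy ⟨(x, y), h, rfl⟩

/-! ### Closedness of the weak gradient -/

section WeakGradient

variable {n : ℕ} {Ω : Set (Sp n)} {α : ℝ}

/-- On compact subsets of the cylinder the weight is bounded away from zero. -/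
theorem exists_restrict_le_smul_weightedMeasure {K : Set (Sp n × ℝ)} (hK : IsCompact K)
    (hKc : K ⊆ cylinder Ω) (α : ℝ) :
    ∃ C : ℝ≥0∞, C ≠ ∞ ∧ ((volume.restrict (cylinder Ω)).restrict K) ≤ C • weightedMeasure Ω α := by
  have hcont : ContinuousOn (fun p : Sp n × ℝ => p.2 ^ α) K := fun p hp =>
    (continuousAt_snd.rpow_const (Or.inl (ne_of_gt (hKc hp).2))).continuousWithinAt
  obtain ⟨m, hm, hmK⟩ := hK.exists_forall_le' hcont
    (a := 0) fun p hp => Real.rpow_pos_of_pos (hKc hp).2 α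
  have hm0 : ENNReal.ofReal m ≠ 0 := by simpa using hm
  -- On `K` one has `1 ≤ m⁻¹ y^α`, with `m > 0` a lower bound of the weight there.
  refine ⟨(ENNReal.ofReal m)⁻¹, ENNReal.inv_ne_top.2 hm0, Measure.le_iff.2 fun s hs => ?_⟩
  have hKm : MeasurableSet K := hK.measurableSet
  rw [Measure.restrict_apply hs, Measure.smul_apply, smul_eq_mul]
  refine le_trans ?_ (mul_le_mul_right (measure_mono (Set.inter_subset_left (t := K))) _)
  rw [weightedMeasure, withDensity_apply _ (hs.inter hKm),
    ← lintegral_const_mul _ (by fun_prop), ← setLIntegral_one]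
  refine setLIntegral_mono (by fun_prop) fun p hp => ?_
  rw [← ENNReal.inv_mul_cancel hm0 ENNReal.ofReal_ne_top]
  exact mul_le_mul_right (ENNReal.ofReal_le_ofReal (hmK p hp.2)) _

variable {E F G : Type*} [NormedAddCommGroup E] [NormedSpace ℝ E] [NormedAddCommGroup F]
  [NormedSpace ℝ F] [NormedAddCommGroup G] [NormedSpace ℝ G]

/-- Weak derivatives are tested in Lebesgue measure, while convergence is in weighted `L²`. A factor
`g` compactly supported in the open cylinder reconciles the two: on its support the weight is
bounded below and the measure is finite. -/
theorem exists_eLpNorm_bilin_le {g : Sp n × ℝ → E} (hg : Continuous g)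
    (hgc : HasCompactSupport g) (hgΩ : tsupport g ⊆ cylinder Ω) (L : E →L[ℝ] F →L[ℝ] G) (α : ℝ) :
    ∃ C : ℝ≥0∞, C ≠ ∞ ∧ ∀ f : Sp n × ℝ → F, AEStronglyMeasurable f (weightedMeasure Ω α) →
      AEStronglyMeasurable (fun p => L (g p) (f p)) (volume.restrict (cylinder Ω)) ∧
      eLpNorm (fun p => L (g p) (f p)) 1 (volume.restrict (cylinder Ω)) ≤
        C * eLpNorm f 2 (weightedMeasure Ω α) := by
  obtain ⟨C, hC, hle⟩ := exists_restrict_le_smul_weightedMeasure hgc.isCompact hgΩ α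
  obtain ⟨M, hM⟩ := hg.bounded_above_of_compact_support hgc
  set K := tsupport g
  set ν := (volume.restrict (cylinder Ω)).restrict K
  have hKm : MeasurableSet K := hgc.isCompact.measurableSet
  have hν : ν Set.univ ≠ ∞ := by
    rw [Measure.restrict_apply_univ]
    exact hgc.isCompact.measure_lt_top.ne
  refine ⟨ENNReal.ofReal (‖L‖ * M) * (C ^ (1 / 2 : ℝ≥0∞).toReal * ν Set.univ ^ (1 / 2 : ℝ)),
    by finiteness, fun f hf => ?_⟩
  have hfν : AEStronglyMeasurable f ν :=
    hf.mono_ac ((Measure.absolutelyContinuous_of_le hle).trans Measure.smul_absolutelyContinuous)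
  have hsupp : Function.support (fun p => L (g p) (f p)) ⊆ K := fun p hp =>
    subset_tsupport g fun h => hp (by simp [h])
  constructor
  · rw [← Set.indicator_eq_self.2 hsupp, aestronglyMeasurable_indicator_iff hKm]
    exact L.aestronglyMeasurable_comp₂ hg.aestronglyMeasurable hfν
  · rw [← eLpNorm_restrict_eq_of_support_subset hsupp]
    calc eLpNorm (fun p => L (g p) (f p)) 1 ν
        ≤ ENNReal.ofReal (‖L‖ * M) * eLpNorm f 1 ν :=
          eLpNorm_le_mul_eLpNorm_of_ae_le_mul (ae_of_all _ fun p =>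
            (L.le_opNorm₂ _ _).trans (by gcongr; exact hM p)) 1
      _ ≤ ENNReal.ofReal (‖L‖ * M) * (eLpNorm f 2 ν * ν Set.univ ^ (1 / 2 : ℝ)) := by
          refine mul_le_mul_right ((eLpNorm_le_eLpNorm_mul_rpow_measure_univ (q := 2)
            (by norm_num) hfν).trans (le_of_eq ?_)) _
          norm_num
      _ ≤ ENNReal.ofReal (‖L‖ * M) * ((C ^ (1 / 2 : ℝ≥0∞).toReal *
            eLpNorm f 2 (weightedMeasure Ω α)) * ν Set.univ ^ (1 / 2 : ℝ)) := by
          gcongr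
          refine (eLpNorm_mono_measure f hle).trans (le_of_eq ?_)
          rw [eLpNorm_smul_measure_of_ne_top (by norm_num), smul_eq_mul]
      _ = _ := by ring

theorem tendsto_integral_bilin {g : Sp n × ℝ → E} (hg : Continuous g)
    (hgc : HasCompactSupport g) (hgΩ : tsupport g ⊆ cylinder Ω) (L : E →L[ℝ] F →L[ℝ] G)
    {f : ℕ → Sp n × ℝ → F} {f₀ : Sp n × ℝ → F} (hf : ∀ k, MemLp (f k) 2 (weightedMeasure Ω α))
    (hf₀ : MemLp f₀ 2 (weightedMeasure Ω α))
    (h : Tendsto (fun k => eLpNorm (fun p => f k p - f₀ p) 2 (weightedMeasure Ω α)) atTop (𝓝 0)) :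
    Tendsto (fun k => ∫ p in cylinder Ω, L (g p) (f k p)) atTop
      (𝓝 (∫ p in cylinder Ω, L (g p) (f₀ p))) := by
  obtain ⟨C, hC, hle⟩ := exists_eLpNorm_bilin_le hg hgc hgΩ L α
  refine tendsto_integral_of_L1' _ (hle f₀ hf₀.1).1 (Eventually.of_forall fun k => ?_) ?_
  · exact memLp_one_iff_integrable.1 ⟨(hle _ (hf k).1).1, (hle _ (hf k).1).2.trans_lt
      (ENNReal.mul_lt_top hC.lt_top (hf k).2)⟩
  · have h0 : Tendsto (fun k => C * eLpNorm (fun p => f k p - f₀ p) 2 (weightedMeasure Ω α))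
        atTop (𝓝 0) := by
      simpa using ENNReal.Tendsto.const_mul h (Or.inr hC)
    refine tendsto_of_tendsto_of_tendsto_of_le_of_le tendsto_const_nhds h0
      (fun _ => zero_le) fun k => ?_
    refine le_trans (le_of_eq ?_) (hle (fun p => f k p - f₀ p) ((hf k).1.sub hf₀.1)).2
    refine eLpNorm_congr_ae (ae_of_all _ fun p => ?_)
    simp

variable {φ ψ : Sp n × ℝ → ℝ} {U : Set (Sp n × ℝ)}

/-- The support of `ψ` stays inside the cylinder, so both integrals extend to the whole space
without boundary terms, even though `φ` need not vanish at `y = 0`. -/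
theorem integral_mul_fderiv_test (hφ : IsTestFunction U φ)
    (hψ : IsTestFunction (cylinder Ω) ψ) (v : Sp n × ℝ) :
    ∫ p in cylinder Ω, φ p * fderiv ℝ ψ p v = - ∫ p in cylinder Ω, ψ p * fderiv ℝ φ p v := by
  have hz : ∀ p ∉ cylinder Ω, p ∉ tsupport ψ := fun p hp h => hp (hψ.tsupport_subset h)
  rw [setIntegral_eq_integral_of_forall_compl_eq_zero fun p hp => by
      simp [fderiv_of_notMem_tsupport ℝ (hz p hp)],
    setIntegral_eq_integral_of_forall_compl_eq_zero fun p hp => by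
      simp [image_eq_zero_of_notMem_tsupport (hz p hp)]]
  have hφd : Continuous fun p => fderiv ℝ φ p v := by
    have := hφ.contDiff.continuous_fderiv (by simp)
    fun_prop
  have hψd : Continuous fun p => fderiv ℝ ψ p v := by
    have := hψ.contDiff.continuous_fderiv (by simp)
    fun_prop
  have hcs : ∀ f : Sp n × ℝ → ℝ, Continuous f → (∀ p ∉ tsupport φ, f p = 0) → Integrable f :=
    fun f hf h => hf.integrable_of_hasCompactSupport (.intro hφ.hasCompactSupport.isCompact h)
  have : (volume : Measure (Sp n × ℝ)).IsAddHaarMeasure := by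
    rw [Measure.volume_eq_prod]
    infer_instance
  have h := integral_mul_fderiv_eq_neg_fderiv_mul_of_integrable (𝕜 := ℝ)
    (μ := (volume : Measure (Sp n × ℝ))) (f := φ) (g := ψ) (v := v)
    (hcs _ (hφd.mul hψ.contDiff.continuous) fun p hp => by
      simp [fderiv_of_notMem_tsupport ℝ hp])
    (hcs _ (hφ.contDiff.continuous.mul hψd) fun p hp => by
      simp [image_eq_zero_of_notMem_tsupport hp])
    (hcs _ (hφ.contDiff.continuous.mul hψ.contDiff.continuous) fun p hp => by
      simp [image_eq_zero_of_notMem_tsupport hp])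
    (fun p _ => (hφ.contDiff.differentiable (by simp)).differentiableAt)
    (fun p _ => (hψ.contDiff.differentiable (by simp)).differentiableAt)
  rw [h]
  simp only [mul_comm]

theorem integral_smul_gradX_test (hφ : IsTestFunction U φ) (hψ : IsTestFunction (cylinder Ω) ψ) :
    ∫ p in cylinder Ω, φ p • gradX ψ p = - ∫ p in cylinder Ω, ψ p • gradX φ p := by
  have hI1 : Integrable (fun p => φ p • gradX ψ p) (volume.restrict (cylinder Ω)) :=
    (hφ.contDiff.continuous.smul (continuous_gradX hψ.contDiff)).integrable_of_hasCompactSupport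
      hφ.hasCompactSupport.smul_right
  have hI2 : Integrable (fun p => ψ p • gradX φ p) (volume.restrict (cylinder Ω)) :=
    (hψ.contDiff.continuous.smul (continuous_gradX hφ.contDiff)).integrable_of_hasCompactSupport
      hψ.hasCompactSupport.smul_right
  refine ext_inner_left ℝ fun v => ?_
  rw [inner_neg_right, ← integral_inner hI1, ← integral_inner hI2]
  have hin : ∀ {χ : Sp n × ℝ → ℝ} (_ : ContDiff ℝ ((⊤ : ℕ∞) : WithTop ℕ∞) χ) (r : ℝ) p,
      inner ℝ v (r • gradX χ p) = r * fderiv ℝ χ p (v, 0) := fun hχ r p => by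
    rw [real_inner_smul_right, real_inner_comm, inner_gradX hχ]
  simp only [hin hψ.contDiff, hin hφ.contDiff]
  exact integral_mul_fderiv_test hφ hψ (v, 0)

theorem integral_mul_derivY_test (hφ : IsTestFunction U φ) (hψ : IsTestFunction (cylinder Ω) ψ) :
    ∫ p in cylinder Ω, φ p * derivY ψ p = - ∫ p in cylinder Ω, ψ p * derivY φ p := by
  simp only [derivY_eq hφ.contDiff, derivY_eq hψ.contDiff]
  exact integral_mul_fderiv_test hφ hψ (0, 1)

/-- Both sides of the classical integration by parts for `φ k` converge, since each pairs an
`L²`-convergent sequence with a fixed compactly supported function. -/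
theorem weak_gradX_of_tendsto [IsFiniteMeasureOnCompacts (weightedMeasure Ω α)]
    {φ : ℕ → Sp n × ℝ → ℝ} (hφ : ∀ k, IsTestFunction U (φ k))
    {v : Sp n × ℝ → ℝ} {g : Sp n × ℝ → Sp n} (hv : MemLp v 2 (weightedMeasure Ω α))
    (hg : MemLp g 2 (weightedMeasure Ω α))
    (h1 : Tendsto (fun k => eLpNorm (fun p => φ k p - v p) 2 (weightedMeasure Ω α)) atTop (𝓝 0))
    (h2 : Tendsto (fun k => eLpNorm (fun p => gradX (φ k) p - g p) 2 (weightedMeasure Ω α))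
      atTop (𝓝 0)) (hψ : IsTestFunction (cylinder Ω) ψ) :
    ∫ p in cylinder Ω, v p • gradX ψ p = - ∫ p in cylinder Ω, ψ p • g p := by
  have t1 := tendsto_integral_bilin (continuous_gradX hψ.contDiff) hψ.hasCompactSupport_gradX
    ((closure_minimal (support_gradX_subset hψ.contDiff) (isClosed_tsupport ψ)).trans
      hψ.tsupport_subset) (ContinuousLinearMap.lsmul ℝ ℝ).flip (fun k => (hφ k).memLp) hv h1
  have t2 := tendsto_integral_bilin hψ.contDiff.continuous hψ.hasCompactSupport
    hψ.tsupport_subset (ContinuousLinearMap.lsmul ℝ ℝ) (fun k => (hφ k).memLp_gradX) hg h2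
  refine tendsto_nhds_unique t1 (t2.neg.congr fun k => ?_)
  exact (integral_smul_gradX_test (hφ k) hψ).symm

theorem weak_gradY_of_tendsto [IsFiniteMeasureOnCompacts (weightedMeasure Ω α)]
    {φ : ℕ → Sp n × ℝ → ℝ} (hφ : ∀ k, IsTestFunction U (φ k))
    {v g : Sp n × ℝ → ℝ} (hv : MemLp v 2 (weightedMeasure Ω α))
    (hg : MemLp g 2 (weightedMeasure Ω α))
    (h1 : Tendsto (fun k => eLpNorm (fun p => φ k p - v p) 2 (weightedMeasure Ω α)) atTop (𝓝 0))
    (h2 : Tendsto (fun k => eLpNorm (fun p => derivY (φ k) p - g p) 2 (weightedMeasure Ω α))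
      atTop (𝓝 0)) (hψ : IsTestFunction (cylinder Ω) ψ) :
    ∫ p in cylinder Ω, v p * derivY ψ p = - ∫ p in cylinder Ω, ψ p * g p := by
  have t1 := tendsto_integral_bilin (continuous_derivY hψ.contDiff) hψ.hasCompactSupport_derivY
    ((closure_minimal (support_derivY_subset hψ.contDiff) (isClosed_tsupport ψ)).trans
      hψ.tsupport_subset) (ContinuousLinearMap.mul ℝ ℝ).flip (fun k => (hφ k).memLp) hv h1
  have t2 := tendsto_integral_bilin hψ.contDiff.continuous hψ.hasCompactSupport
    hψ.tsupport_subset (ContinuousLinearMap.mul ℝ ℝ) (fun k => (hφ k).memLp_derivY) hg h2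
  refine tendsto_nhds_unique t1 (t2.neg.congr fun k => ?_)
  exact (integral_mul_derivY_test (hφ k) hψ).symm

end WeakGradient

/-! ### The energy space as a Hilbert space -/

/-- Triples `(w, ∇_{x'} w, ∂_y w)` in the weighted `L²` space. -/
abbrev Ambient {n : ℕ} (Ω : Set (Sp n)) (α : ℝ) : Type :=
  WithLp 2 (Lp ℝ 2 (weightedMeasure Ω α) ×
    WithLp 2 (Lp (Sp n) 2 (weightedMeasure Ω α) × Lp ℝ 2 (weightedMeasure Ω α)))

/-- Smooth functions vanishing near the lateral boundary. -/
abbrev LateralTest {n : ℕ} (Ω : Set (Sp n)) : Type :=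
  testFunctions (Ω ×ˢ (Set.univ : Set ℝ))

section Energy

variable {n : ℕ} {Ω : Set (Sp n)} {α : ℝ}

/-- The triple of a function of the weighted Sobolev space and its weak derivatives. -/
def WeightedH1.toAmbient (w : WeightedH1 Ω α) : Ambient Ω α :=
  WithLp.toLp 2 (w.val, WithLp.toLp 2 (w.gradX, w.gradY))

theorem WeightedH1.toAmbient_injective :
    Function.Injective (WeightedH1.toAmbient (Ω := Ω) (α := α)) := fun _ _ h =>
  WeightedH1.ext (congrArg (fun x => x.fst) h) (congrArg (fun x => x.snd.fst) h)
    (congrArg (fun x => x.snd.snd) h)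

variable (Ω α) in
/-- The triple of a smooth function and its classical derivatives. -/
noncomputable def testEmbed [IsFiniteMeasureOnCompacts (weightedMeasure Ω α)] :
    LateralTest Ω →ₗ[ℝ] Ambient Ω α where
  toFun φ := WithLp.toLp 2 (φ.2.memLp.toLp φ.1,
    WithLp.toLp 2 (φ.2.memLp_gradX.toLp (gradX φ.1), φ.2.memLp_derivY.toLp (derivY φ.1)))
  map_add' φ ψ := by
    simp only [← WithLp.toLp_add, Prod.mk_add_mk, ← MemLp.toLp_add, Submodule.coe_add,
      gradX_add φ.2.contDiff ψ.2.contDiff, derivY_add φ.2.contDiff ψ.2.contDiff]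
  map_smul' r φ := by
    simp only [← WithLp.toLp_smul, Prod.smul_mk, ← MemLp.toLp_const_smul, Submodule.coe_smul,
      gradX_smul r φ.2.contDiff, derivY_smul r φ.2.contDiff, RingHom.id_apply]

variable (Ω) in
/-- The restriction of smooth functions to `Ω × {0}`. -/
noncomputable def testTrace : LateralTest Ω →ₗ[ℝ] L2 Ω where
  toFun φ := (φ.2.memLp_trace Ω).toLp fun x => φ.1 (x, 0)
  map_add' _ _ := rfl
  map_smul' _ _ := rfl

theorem toLp_val_eq_iff_tendsto {E : Type*} [NormedAddCommGroup E] {X : Type*} [MeasurableSpace X]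
    {μ : Measure X} {f : ℕ → X → E} (hf : ∀ k, MemLp (f k) 2 μ) (g : Lp E 2 μ) :
    Tendsto (fun k => (hf k).toLp (f k)) atTop (𝓝 g) ↔
      Tendsto (fun k => eLpNorm (fun p => f k p - g p) 2 μ) atTop (𝓝 0) := by
  have h := Lp.tendsto_Lp_iff_tendsto_eLpNorm'' (fi := atTop) f hf g (Lp.memLp g)
  rw [Lp.toLp_coeFn] at h
  exact h

theorem WithLp.tendsto_prod_iff {E F ι : Type*} [TopologicalSpace E] [TopologicalSpace F]
    {l : Filter ι} {f : ι → WithLp 2 (E × F)} {x : WithLp 2 (E × F)} :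
    Tendsto f l (𝓝 x) ↔
      Tendsto (fun k => (f k).fst) l (𝓝 x.fst) ∧ Tendsto (fun k => (f k).snd) l (𝓝 x.snd) := by
  rw [(WithLp.homeomorphProd 2 E F).isInducing.tendsto_nhds_iff, Prod.tendsto_iff]
  rfl

theorem tendstoH1_iff [IsFiniteMeasureOnCompacts (weightedMeasure Ω α)] (φ : ℕ → LateralTest Ω)
    (w : WeightedH1 Ω α) :
    TendstoH1 (fun k => (φ k).1) w ↔
      Tendsto (fun k => testEmbed Ω α (φ k)) atTop (𝓝 w.toAmbient) := by
  rw [WithLp.tendsto_prod_iff, WithLp.tendsto_prod_iff]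
  exact and_congr (toLp_val_eq_iff_tendsto (fun k => (φ k).2.memLp) w.val).symm
    (and_congr (toLp_val_eq_iff_tendsto (fun k => (φ k).2.memLp_gradX) w.gradX).symm
      (toLp_val_eq_iff_tendsto (fun k => (φ k).2.memLp_derivY) w.gradY).symm)

variable (Ω α) in
/-- The closure of the smooth functions vanishing near the lateral boundary. -/
noncomputable def energySpace [IsFiniteMeasureOnCompacts (weightedMeasure Ω α)] :
    Submodule ℝ (Ambient Ω α) :=
  (LinearMap.range (testEmbed Ω α)).topologicalClosure

section FiniteOnCompacts

variable [IsFiniteMeasureOnCompacts (weightedMeasure Ω α)]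

variable (Ω α) in
/-- The energy space as a Hilbert space in its own right. -/
def Energy : Type := energySpace Ω α

noncomputable instance : NormedAddCommGroup (Energy Ω α) :=
  inferInstanceAs (NormedAddCommGroup (energySpace Ω α))

noncomputable instance : InnerProductSpace ℝ (Energy Ω α) :=
  inferInstanceAs (InnerProductSpace ℝ (energySpace Ω α))

instance : CompleteSpace (Energy Ω α) :=
  (Submodule.isClosed_topologicalClosure _).completeSpace_coe

theorem mem_energySpace_iff {x : Ambient Ω α} :
    x ∈ energySpace Ω α ↔
      ∃ φ : ℕ → LateralTest Ω, Tendsto (fun k => testEmbed Ω α (φ k)) atTop (𝓝 x) := by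
  rw [energySpace, ← SetLike.mem_coe, Submodule.topologicalClosure_coe,
    mem_closure_iff_seq_limit]
  constructor
  · rintro ⟨y, hy, hlim⟩
    choose φ hφ using hy
    exact ⟨φ, by simpa only [hφ] using hlim⟩
  · rintro ⟨φ, hφ⟩
    exact ⟨_, fun k => ⟨φ k, rfl⟩, hφ⟩

theorem vanishesLaterally_iff (w : WeightedH1 Ω α) :
    w.VanishesLaterally ↔ w.toAmbient ∈ energySpace Ω α := by
  rw [mem_energySpace_iff]
  constructor
  · rintro ⟨φ, hφ, h⟩
    exact ⟨fun k => ⟨φ k, hφ k⟩, (tendstoH1_iff _ w).1 h⟩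
  · rintro ⟨φ, h⟩
    exact ⟨fun k => (φ k).1, fun k => (φ k).2, (tendstoH1_iff _ w).2 h⟩

/-- Closedness of the weak gradient: the last two components of a limit of test triples are the weak
derivatives of the first. This gives surjectivity of `toEnergy`. -/
theorem exists_toAmbient_eq {x : Ambient Ω α} (hx : x ∈ energySpace Ω α) :
    ∃ w : WeightedH1 Ω α, w.toAmbient = x := by
  obtain ⟨φ, hφ⟩ := mem_energySpace_iff.1 hx
  rw [WithLp.tendsto_prod_iff, WithLp.tendsto_prod_iff] at hφ
  have h1 := (toLp_val_eq_iff_tendsto (fun k => (φ k).2.memLp) x.fst).1 hφ.1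
  have h2 := (toLp_val_eq_iff_tendsto (fun k => (φ k).2.memLp_gradX) x.snd.fst).1 hφ.2.1
  have h3 := (toLp_val_eq_iff_tendsto (fun k => (φ k).2.memLp_derivY) x.snd.snd).1 hφ.2.2
  exact ⟨⟨x.fst, x.snd.fst, x.snd.snd,
    fun ψ hψ => weak_gradX_of_tendsto (fun k => (φ k).2) (Lp.memLp _) (Lp.memLp _) h1 h2 hψ,
    fun ψ hψ => weak_gradY_of_tendsto (fun k => (φ k).2) (Lp.memLp _) (Lp.memLp _) h1 h3 hψ⟩, rfl⟩

variable (Ω α) in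
/-- The identification of `H̊¹_L(y^α, 𝒞)` with the energy space. -/
noncomputable def toEnergy : HL Ω α ≃ Energy Ω α :=
  Equiv.ofBijective (fun w => ⟨w.1.toAmbient, (vanishesLaterally_iff w.1).1 w.2⟩) <| by
    constructor
    · intro v w h
      exact Subtype.ext (WeightedH1.toAmbient_injective (congrArg Subtype.val h))
    · rintro ⟨x, hx⟩
      obtain ⟨w, rfl⟩ := exists_toAmbient_eq hx
      exact ⟨⟨w, (vanishesLaterally_iff w).2 hx⟩, rfl⟩

/-! ### The trace operator -/

theorem norm_toLp_sq {E : Type*} [NormedAddCommGroup E] [InnerProductSpace ℝ E] {X : Type*}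
    [MeasurableSpace X] {μ : Measure X} {f : X → E} (hf : MemLp f 2 μ) :
    ‖hf.toLp f‖ ^ 2 = ∫ x, ‖f x‖ ^ 2 ∂μ := by
  rw [← real_inner_self_eq_norm_sq, L2.inner_def]
  refine integral_congr_ae ?_
  filter_upwards [hf.coeFn_toLp] with x hx
  rw [hx, real_inner_self_eq_norm_sq]

theorem norm_testTrace_le (hα : -1 < α) (hα1 : α < 1) (φ : LateralTest Ω) :
    ‖testTrace Ω φ‖ ≤ Real.sqrt (2 / (1 - α)) * ‖testEmbed Ω α φ‖ := by
  have hc : 0 ≤ 2 / (1 - α) := div_nonneg two_pos.le (by linarith)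
  refine (sq_le_sq₀ (norm_nonneg _) (by positivity)).1 ?_
  rw [mul_pow, Real.sq_sqrt hc, WithLp.prod_norm_sq_eq_of_L2, WithLp.prod_norm_sq_eq_of_L2]
  refine le_trans ?_ (mul_le_mul_of_nonneg_left (add_le_add_right
    (le_add_of_nonneg_left (sq_nonneg _)) _) hc)
  change ‖(φ.2.memLp_trace Ω).toLp _‖ ^ 2 ≤ 2 / (1 - α) *
    (‖φ.2.memLp.toLp φ.1‖ ^ 2 + ‖φ.2.memLp_derivY.toLp (derivY φ.1)‖ ^ 2)
  simp only [norm_toLp_sq, Real.norm_eq_abs, sq_abs]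
  exact integral_trace_sq_le hα hα1 φ.2

variable (Ω α) in
/-- Smooth functions as elements of the energy space. -/
noncomputable def testEnergy : LateralTest Ω →ₗ[ℝ] Energy Ω α :=
  (testEmbed Ω α).codRestrict (energySpace Ω α) fun φ =>
    Submodule.le_topologicalClosure _ (LinearMap.mem_range_self _ φ)

theorem denseRange_testEnergy : DenseRange (testEnergy Ω α) := by
  intro x
  obtain ⟨φ, hφ⟩ := mem_energySpace_iff.1 x.2
  exact mem_closure_of_tendsto (tendsto_subtype_rng.2 hφ)
    (Eventually.of_forall fun k => ⟨φ k, rfl⟩)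

variable (Ω α) in
/-- The continuous extension of the restriction to `Ω × {0}`. -/
noncomputable def traceEnergy : Energy Ω α →L[ℝ] L2 Ω :=
  (testTrace Ω).extendOfNorm (testEnergy Ω α)

/-- Density and the trace inequality are what make `extendOfNorm` a genuine extension; this is where
`-1 < α < 1` enters. -/
theorem traceEnergy_testEnergy (hα : -1 < α) (hα1 : α < 1) (φ : LateralTest Ω) :
    traceEnergy Ω α (testEnergy Ω α φ) = testTrace Ω φ :=
  LinearMap.extendOfNorm_eq denseRange_testEnergy ⟨_, norm_testTrace_le hα hα1⟩ φ

/-- By continuity of `traceEnergy`, the traces of every approximating sequence have the same limit.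
This gives uniqueness, and existence follows from any sequence witnessing lateral vanishing. -/
theorem isTrace_iff (hα : -1 < α) (hα1 : α < 1) (w : HL Ω α) (v : L2 Ω) :
    IsTrace w v ↔ v = traceEnergy Ω α (toEnergy Ω α w) := by
  have key : ∀ φ : ℕ → LateralTest Ω, TendstoH1 (fun k => (φ k).1) w.1 →
      Tendsto (fun k => testTrace Ω (φ k)) atTop (𝓝 (traceEnergy Ω α (toEnergy Ω α w))) := by
    intro φ hφ
    have h : Tendsto (fun k => testEnergy Ω α (φ k)) atTop (𝓝 (toEnergy Ω α w)) :=
      tendsto_subtype_rng.2 ((tendstoH1_iff φ w.1).1 hφ)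
    simpa only [Function.comp_def, traceEnergy_testEnergy hα hα1] using
      ((traceEnergy Ω α).continuous.tendsto _).comp h
  constructor
  · rintro ⟨φ, hφ, h, hv⟩
    exact tendsto_nhds_unique
      ((toLp_val_eq_iff_tendsto (fun k => (hφ k).memLp_trace Ω) v).2 hv)
      (key (fun k => ⟨φ k, hφ k⟩) h)
  · rintro rfl
    obtain ⟨φ, hφ, h⟩ := w.2
    exact ⟨φ, hφ, h, (toLp_val_eq_iff_tendsto (fun k => (hφ k).memLp_trace Ω) _).1
      (key (fun k => ⟨φ k, hφ k⟩) h)⟩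

theorem tr_eq (hα : -1 < α) (hα1 : α < 1) (w : HL Ω α) :
    tr w = traceEnergy Ω α (toEnergy Ω α w) :=
  (isTrace_iff hα hα1 w _).1 (Classical.epsilon_spec
    (p := fun u => IsTrace w u) ⟨_, (isTrace_iff hα hα1 w _).2 rfl⟩)

/-- Both sides are continuous in the ambient norm, so the Poincaré inequality passes from test
functions to their limits. -/
theorem norm_fst_sq_le (hn : 1 ≤ n) (hα : -1 < α) {R : ℝ} (hR : ∀ x ∈ Ω, ‖x‖ ≤ R)
    (x : energySpace Ω α) : ‖x.1.fst‖ ^ 2 ≤ 4 * R ^ 2 * ‖x.1.snd.fst‖ ^ 2 := by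
  obtain ⟨φ, hφ⟩ := mem_energySpace_iff.1 x.2
  rw [WithLp.tendsto_prod_iff, WithLp.tendsto_prod_iff] at hφ
  refine le_of_tendsto_of_tendsto' (hφ.1.norm.pow 2) ((hφ.2.1.norm.pow 2).const_mul _) fun k => ?_
  change ‖(φ k).2.memLp.toLp (φ k).1‖ ^ 2 ≤
    4 * R ^ 2 * ‖(φ k).2.memLp_gradX.toLp (gradX (φ k).1)‖ ^ 2
  rw [norm_toLp_sq, norm_toLp_sq]
  simp only [Real.norm_eq_abs, sq_abs]
  exact integral_sq_le_integral_gradX_sq hn hα hR (φ k).2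

end FiniteOnCompacts

end Energy

/-! ### Bounded coefficients -/

theorem memLp_top_comp_fst {n : ℕ} {Ω : Set (Sp n)} (α : ℝ) {E : Type*} [NormedAddCommGroup E]
    {f : Sp n → E} (hf : MemLp f ∞ (volume.restrict Ω)) :
    MemLp (fun p : Sp n × ℝ => f p.1) ∞ (weightedMeasure Ω α) := by
  have hq := quasiMeasurePreserving_fst Ω α
  have htop : eLpNormEssSup f (volume.restrict Ω) ≠ ∞ := by
    simpa [eLpNorm_exponent_top] using hf.2.ne
  have hle : ∀ᵐ x ∂(volume.restrict Ω),
      ‖f x‖ₑ ≤ ((eLpNormEssSup f (volume.restrict Ω)).toNNReal : ℝ≥0∞) := by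
    rw [ENNReal.coe_toNNReal htop]
    exact ae_le_eLpNormEssSup
  have hle' := hq.ae hle
  exact memLp_top_of_bound_enorm (hf.1.comp_quasiMeasurePreserving hq) _ hle'

theorem memLp_top_of_lipschitzOnWith {n : ℕ} {Ω : Set (Sp n)} (hΩ : MeasurableSet Ω)
    (hΩb : Bornology.IsBounded Ω) {f : Sp n → ℝ} {K : NNReal} (hf : LipschitzOnWith K f Ω) :
    MemLp f ∞ (volume.restrict Ω) := by
  obtain ⟨g, hg, hfg⟩ := hf.extend_real
  obtain ⟨C, hC⟩ := (hg.isBounded_image hΩb).exists_norm_le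
  refine memLp_top_of_bound (hf.continuousOn.aestronglyMeasurable hΩ) C ?_
  filter_upwards [ae_restrict_mem hΩ] with x hx
  rw [hfg hx]
  exact hC _ ⟨x, hx, rfl⟩

/-- Expanding in elementary matrices writes the operator field as a finite sum of fixed operators
with bounded measurable scalar coefficients. -/
theorem memLp_top_toEuclideanCLM {n : ℕ} {X : Type*} [MeasurableSpace X] {ν : Measure X}
    {A : X → Matrix (Fin n) (Fin n) ℝ} (hA : ∀ i j, MemLp (fun x => A x i j) ∞ ν) :
    MemLp (fun x => Matrix.toEuclideanCLM (𝕜 := ℝ) (A x)) ∞ ν := by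
  let L : Fin n → Fin n → ℝ →L[ℝ] Sp n →L[ℝ] Sp n := fun i j =>
    ContinuousLinearMap.toSpanSingleton ℝ
      (Matrix.toEuclideanCLM (n := Fin n) (𝕜 := ℝ) (Matrix.single i j 1))
  have h : (fun x => Matrix.toEuclideanCLM (𝕜 := ℝ) (A x)) =
      fun x => ∑ i, ∑ j, L i j (A x i j) := by
    funext x
    conv_lhs => rw [Matrix.matrix_eq_sum_single (A x)]
    simp only [L, map_sum, ContinuousLinearMap.toSpanSingleton_apply, ← map_smul,
      Matrix.smul_single, smul_eq_mul, mul_one]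
  rw [h]
  refine memLp_finsetSum (f := fun i x => ∑ j, L i j (A x i j)) _ fun i _ => ?_
  refine memLp_finsetSum (f := fun j x => L i j (A x i j)) _ fun j _ => ?_
  exact (L i j).comp_memLp' (hA i j)

/-- Multiplication by a bounded operator-valued coefficient. -/
theorem exists_mulCLM {E X : Type*} [NormedAddCommGroup E] [NormedSpace ℝ E] [MeasurableSpace X]
    {ν : Measure X} {N : X → E →L[ℝ] E} (hN : MemLp N ∞ ν) :
    ∃ M : Lp E 2 ν →L[ℝ] Lp E 2 ν, ∀ f, M f =ᵐ[ν] fun x => N x (f x) := by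
  refine ⟨(ContinuousLinearMap.id ℝ (E →L[ℝ] E)).holderL ν ∞ 2 2 (hN.toLp N), fun f => ?_⟩
  filter_upwards [(ContinuousLinearMap.id ℝ (E →L[ℝ] E)).coeFn_holder (r := 2) (hN.toLp N) f,
    hN.coeFn_toLp] with x h1 h2
  have : (ContinuousLinearMap.id ℝ (E →L[ℝ] E)).holderL ν ∞ 2 2 (hN.toLp N) f =
    (ContinuousLinearMap.id ℝ (E →L[ℝ] E)).holder 2 (hN.toLp N) f := rfl
  rw [this, h1, h2]
  rfl

/-- The bilinear form `(x, y) ↦ ⟪S x, T y⟫`. -/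
theorem exists_innerCLM {V E : Type*} [NormedAddCommGroup V] [NormedSpace ℝ V]
    [NormedAddCommGroup E] [InnerProductSpace ℝ E] (S T : V →L[ℝ] E) :
    ∃ B : V →L[ℝ] V →L[ℝ] ℝ, ∀ x y, B x y = inner ℝ (S x) (T y) := by
  refine ⟨LinearMap.mkContinuous₂ (LinearMap.mk₂ ℝ (fun x y => inner ℝ (S x) (T y))
    (by simp [inner_add_left]) (by simp [real_inner_smul_left])
    (by simp [inner_add_right]) (by simp [real_inner_smul_right])) (‖S‖ * ‖T‖) fun x y => ?_,
    fun x y => rfl⟩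
  refine (abs_real_inner_le_norm _ _).trans ?_
  calc ‖S x‖ * ‖T y‖ ≤ (‖S‖ * ‖x‖) * (‖T‖ * ‖y‖) := by
        gcongr <;> exact ContinuousLinearMap.le_opNorm _ _
    _ = ‖S‖ * ‖T‖ * ‖x‖ * ‖y‖ := by ring

/-! ### The bilinear form -/

theorem dConst_pos {s : ℝ} (hs0 : 0 < s) (hs1 : s < 1) : 0 < dConst s := by
  have h1 := Real.Gamma_pos_of_pos hs0
  have h2 := Real.Gamma_pos_of_pos (sub_pos.2 hs1)
  unfold dConst
  positivity

/-- Encoding `A` as a bounded multiplication operator turns its pointwise symmetry and ellipticity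
into operator properties, so that coercivity can be argued abstractly. -/
theorem exists_diffusionCLM {n : ℕ} {Ω : Set (Sp n)} (hΩo : IsOpen Ω)
    (hΩb : Bornology.IsBounded Ω) (α : ℝ) {A : Sp n → Matrix (Fin n) (Fin n) ℝ}
    (hAlip : ∀ i j, ∃ K : NNReal, LipschitzOnWith K (fun x => A x i j) Ω)
    (hAsymm : ∀ x ∈ Ω, (A x).IsSymm) {l : ℝ}
    (hAell : ∀ x ∈ Ω, ∀ ξ : Sp n, l * ‖ξ‖ ^ 2 ≤ (A x *ᵥ ξ.ofLp) ⬝ᵥ ξ.ofLp) :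
    ∃ M : Lp (Sp n) 2 (weightedMeasure Ω α) →L[ℝ] Lp (Sp n) 2 (weightedMeasure Ω α),
      (∀ f g : Lp (Sp n) 2 (weightedMeasure Ω α),
        (fun p => inner ℝ (M f p) (g p)) =ᵐ[weightedMeasure Ω α]
        fun p => (A p.1 *ᵥ (f p).ofLp) ⬝ᵥ (g p).ofLp) ∧
      (∀ f g, inner ℝ (M f) g = inner ℝ (M g) f) ∧
      ∀ f, l * ‖f‖ ^ 2 ≤ inner ℝ (M f) f := by
  have hΩm := hΩo.measurableSet
  obtain ⟨M, hM⟩ := exists_mulCLM (memLp_top_toEuclideanCLM fun i j =>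
    memLp_top_comp_fst α (memLp_top_of_lipschitzOnWith hΩm hΩb (hAlip i j).choose_spec))
  have hMae : ∀ f g : Lp (Sp n) 2 (weightedMeasure Ω α),
      (fun p => inner ℝ (M f p) (g p)) =ᵐ[weightedMeasure Ω α]
        fun p => (A p.1 *ᵥ (f p).ofLp) ⬝ᵥ (g p).ofLp := fun f g => by
    filter_upwards [hM f] with p hp
    rw [hp, real_inner_comm]
    exact (Matrix.inner_toEuclideanCLM _ _ _).trans (dotProduct_comm _ _)
  refine ⟨M, hMae, fun f g => ?_, fun f => ?_⟩
  · rw [L2.inner_def, L2.inner_def, integral_congr_ae (hMae f g), integral_congr_ae (hMae g f)]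
    refine integral_congr_ae ?_
    filter_upwards [ae_fst_mem hΩm α] with p hp
    rw [dotProduct_comm, Matrix.dotProduct_mulVec, ← Matrix.mulVec_transpose, (hAsymm _ hp).eq]
  · rw [← real_inner_self_eq_norm_sq, L2.inner_def, L2.inner_def, ← integral_const_mul]
    refine integral_mono_ae ((L2.integrable_inner f f).const_mul l)
      (L2.integrable_inner (M f) f) ?_
    filter_upwards [ae_fst_mem hΩm α, hMae f f] with p hp h
    rw [h, real_inner_self_eq_norm_sq]
    exact hAell _ hp _

theorem exists_reactionCLM {n : ℕ} {Ω : Set (Sp n)} (α : ℝ) {c : Sp n → ℝ}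
    (hcL : MemLp c ∞ (volume.restrict Ω))
    (hc0 : ∀ᵐ x ∂((volume : Measure (Sp n)).restrict Ω), 0 ≤ c x) :
    ∃ M : Lp ℝ 2 (weightedMeasure Ω α) →L[ℝ] Lp ℝ 2 (weightedMeasure Ω α),
      (∀ f g : Lp ℝ 2 (weightedMeasure Ω α),
        (fun p => inner ℝ (M f p) (g p)) =ᵐ[weightedMeasure Ω α]
        fun p => c p.1 * f p * g p) ∧
      (∀ f g, inner ℝ (M f) g = inner ℝ (M g) f) ∧ ∀ f, 0 ≤ inner ℝ (M f) f := by
  obtain ⟨M, hM⟩ := exists_mulCLM (ν := weightedMeasure Ω α) (N := fun p : Sp n × ℝ =>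
      ContinuousLinearMap.toSpanSingleton ℝ (ContinuousLinearMap.id ℝ ℝ) (c p.1))
    (ContinuousLinearMap.comp_memLp' _ (memLp_top_comp_fst α hcL))
  have hMae : ∀ f g : Lp ℝ 2 (weightedMeasure Ω α),
      (fun p => inner ℝ (M f p) (g p)) =ᵐ[weightedMeasure Ω α]
        fun p => c p.1 * f p * g p := fun f g => by
    filter_upwards [hM f] with p hp
    rw [hp]
    simp [mul_comm]
  refine ⟨M, hMae, fun f g => ?_, fun f => ?_⟩
  · rw [L2.inner_def, L2.inner_def, integral_congr_ae (hMae f g), integral_congr_ae (hMae g f)]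
    simp only [mul_right_comm]
  · rw [L2.inner_def, integral_congr_ae (hMae f f)]
    refine integral_nonneg_of_ae ?_
    filter_upwards [(quasiMeasurePreserving_fst Ω α).ae hc0] with p hp
    rw [mul_assoc]
    exact mul_nonneg hp (mul_self_nonneg _)

section Form

/-- By `hx`, the first two components contribute at most `(K + 1) ‖x.snd.fst‖²` to the squared norm,
hence the factor `l / (K + 1)`. The `1` in the minimum serves the `y`-derivative. -/
theorem min_mul_norm_sq_le_energy {E F G : Type*} [NormedAddCommGroup E]
    [NormedAddCommGroup F] [NormedAddCommGroup G] {K l : ℝ} (hK : 0 ≤ K) (hl : 0 < l)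
    {x : WithLp 2 (E × WithLp 2 (F × G))} (hx : ‖x.fst‖ ^ 2 ≤ K * ‖x.snd.fst‖ ^ 2) :
    min (l / (K + 1)) 1 * ‖x‖ ^ 2 ≤ l * ‖x.snd.fst‖ ^ 2 + ‖x.snd.snd‖ ^ 2 := by
  have hK1 : 0 < K + 1 := by positivity
  rw [WithLp.prod_norm_sq_eq_of_L2, WithLp.prod_norm_sq_eq_of_L2]
  have h3 : min (l / (K + 1)) 1 * ((K + 1) * ‖x.snd.fst‖ ^ 2) ≤ l * ‖x.snd.fst‖ ^ 2 := by
    rw [← mul_assoc]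
    refine mul_le_mul_of_nonneg_right ?_ (sq_nonneg _)
    exact (le_div_iff₀ hK1).1 (min_le_left _ _)
  have h4 : min (l / (K + 1)) 1 * ‖x.snd.snd‖ ^ 2 ≤ ‖x.snd.snd‖ ^ 2 :=
    mul_le_of_le_one_left (sq_nonneg _) (min_le_right _ _)
  have h5 : min (l / (K + 1)) 1 * ‖x.fst‖ ^ 2 ≤ min (l / (K + 1)) 1 * (K * ‖x.snd.fst‖ ^ 2) :=
    mul_le_mul_of_nonneg_left hx (by positivity)
  linarith

variable {E F G : Type*} [NormedAddCommGroup E] [InnerProductSpace ℝ E] [NormedAddCommGroup F]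
  [InnerProductSpace ℝ F] [NormedAddCommGroup G] [InnerProductSpace ℝ G]

theorem exists_energyForm (V : Submodule ℝ (WithLp 2 (E × WithLp 2 (F × G)))) (r : ℝ)
    (MA : F →L[ℝ] F) (Mc : E →L[ℝ] E) :
    ∃ B : V →L[ℝ] V →L[ℝ] ℝ, ∀ x y, B x y = r *
      (inner ℝ (MA x.1.snd.fst) y.1.snd.fst + inner ℝ x.1.snd.snd y.1.snd.snd +
        inner ℝ (Mc x.1.fst) y.1.fst) := by
  let P1 : V →L[ℝ] E := WithLp.fstL 2 ℝ _ _ ∘L V.subtypeL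
  let P : V →L[ℝ] WithLp 2 (F × G) := WithLp.sndL 2 ℝ _ _ ∘L V.subtypeL
  obtain ⟨B1, hB1⟩ := exists_innerCLM (Mc ∘L P1) P1
  obtain ⟨B2, hB2⟩ := exists_innerCLM (MA ∘L WithLp.fstL 2 ℝ _ _ ∘L P) (WithLp.fstL 2 ℝ _ _ ∘L P)
  obtain ⟨B3, hB3⟩ := exists_innerCLM (WithLp.sndL 2 ℝ _ _ ∘L P) (WithLp.sndL 2 ℝ _ _ ∘L P)
  refine ⟨r • (B2 + B3 + B1), fun x y => ?_⟩
  change r * (B2 x y + B3 x y + B1 x y) = _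
  rw [hB1, hB2, hB3]
  rfl

theorem exists_coercive_energyForm (V : Submodule ℝ (WithLp 2 (E × WithLp 2 (F × G))))
    {r K l : ℝ} (hr : 0 < r) (hK : 0 ≤ K) (hl : 0 < l)
    (hV : ∀ x : V, ‖x.1.fst‖ ^ 2 ≤ K * ‖x.1.snd.fst‖ ^ 2)
    {MA : F →L[ℝ] F} (hMAsymm : ∀ f g, inner ℝ (MA f) g = inner ℝ (MA g) f)
    (hMAell : ∀ f, l * ‖f‖ ^ 2 ≤ inner ℝ (MA f) f)
    {Mc : E →L[ℝ] E} (hMcsymm : ∀ f g, inner ℝ (Mc f) g = inner ℝ (Mc g) f)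
    (hMcnonneg : ∀ f, 0 ≤ inner ℝ (Mc f) f) :
    ∃ B : V →L[ℝ] V →L[ℝ] ℝ, IsCoercive B ∧ (∀ x y, B x y = B y x) ∧ ∀ x y, B x y = r *
      (inner ℝ (MA x.1.snd.fst) y.1.snd.fst + inner ℝ x.1.snd.snd y.1.snd.snd +
        inner ℝ (Mc x.1.fst) y.1.fst) := by
  obtain ⟨B, hB⟩ := exists_energyForm V r MA Mc
  refine ⟨B, ⟨r * min (l / (K + 1)) 1, by positivity, fun x => ?_⟩, fun x y => ?_, hB⟩
  · rw [hB, mul_assoc, mul_assoc, ← sq]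
    refine mul_le_mul_of_nonneg_left ?_ hr.le
    refine (min_mul_norm_sq_le_energy hK hl (hV x)).trans ?_
    rw [← real_inner_self_eq_norm_sq x.1.snd.snd]
    have h1 := hMAell x.1.snd.fst
    have h2 := hMcnonneg x.1.fst
    linarith
  · rw [hB, hB, hMAsymm, hMcsymm, real_inner_comm x.1.snd.snd]

end Form

theorem form_eq_inner {n : ℕ} {Ω : Set (Sp n)} {s : ℝ} {A : Sp n → Matrix (Fin n) (Fin n) ℝ}
    {c : Sp n → ℝ}
    {MA : Lp (Sp n) 2 (weightedMeasure Ω (1 - 2 * s)) →L[ℝ]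
      Lp (Sp n) 2 (weightedMeasure Ω (1 - 2 * s))}
    (hMA : ∀ f g : Lp (Sp n) 2 (weightedMeasure Ω (1 - 2 * s)),
      (fun p => inner ℝ (MA f p) (g p)) =ᵐ[weightedMeasure Ω (1 - 2 * s)]
        fun p => (A p.1 *ᵥ (f p).ofLp) ⬝ᵥ (g p).ofLp)
    {Mc : Lp ℝ 2 (weightedMeasure Ω (1 - 2 * s)) →L[ℝ] Lp ℝ 2 (weightedMeasure Ω (1 - 2 * s))}
    (hMc : ∀ f g : Lp ℝ 2 (weightedMeasure Ω (1 - 2 * s)),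
      (fun p => inner ℝ (Mc f p) (g p)) =ᵐ[weightedMeasure Ω (1 - 2 * s)]
        fun p => c p.1 * f p * g p) (w φ : HL Ω (1 - 2 * s)) :
    form Ω s A c w φ = 1 / dConst s * (inner ℝ (MA w.1.gradX) φ.1.gradX +
      inner ℝ w.1.gradY φ.1.gradY + inner ℝ (Mc w.1.val) φ.1.val) := by
  rw [form, L2.inner_def, L2.inner_def, L2.inner_def, ← integral_add (L2.integrable_inner _ _)
    (L2.integrable_inner _ _), ← integral_add ((L2.integrable_inner _ _).add
    (L2.integrable_inner _ _)) (L2.integrable_inner _ _)]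
  congr 1
  refine integral_congr_ae ?_
  filter_upwards [hMA w.1.gradX φ.1.gradX, hMc w.1.val φ.1.val] with p h1 h2
  have h3 : (inner ℝ (w.1.gradY p) (φ.1.gradY p) : ℝ) = w.1.gradY p * φ.1.gradY p := by
    simp [mul_comm]
  rw [← h1, ← h2, ← h3]

theorem exists_coercive_form {n : ℕ} (hn : 1 ≤ n) {Ω : Set (Sp n)} (hΩo : IsOpen Ω)
    (hΩb : Bornology.IsBounded Ω) {s : ℝ} (hs0 : 0 < s) (hs1 : s < 1)
    {A : Sp n → Matrix (Fin n) (Fin n) ℝ}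
    (hAlip : ∀ i j, ∃ K : NNReal, LipschitzOnWith K (fun x => A x i j) Ω)
    (hAsymm : ∀ x ∈ Ω, (A x).IsSymm)
    (hAell : ∃ l : ℝ, 0 < l ∧ ∀ x ∈ Ω, ∀ ξ : Sp n, l * ‖ξ‖ ^ 2 ≤ (A x *ᵥ ξ.ofLp) ⬝ᵥ ξ.ofLp)
    {c : Sp n → ℝ} (hcL : MemLp c ∞ (volume.restrict Ω))
    (hc0 : ∀ᵐ x ∂((volume : Measure (Sp n)).restrict Ω), 0 ≤ c x)
    [IsFiniteMeasureOnCompacts (weightedMeasure Ω (1 - 2 * s))] :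
    ∃ B : Energy Ω (1 - 2 * s) →L[ℝ] Energy Ω (1 - 2 * s) →L[ℝ] ℝ,
      IsCoercive B ∧ (∀ x y, B x y = B y x) ∧
      ∀ w φ : HL Ω (1 - 2 * s), form Ω s A c w φ =
        B (toEnergy Ω (1 - 2 * s) w) (toEnergy Ω (1 - 2 * s) φ) := by
  obtain ⟨l, hl, hell⟩ := hAell
  have hd := dConst_pos hs0 hs1
  obtain ⟨MA, hMAae, hMAsymm, hMAell⟩ :=
    exists_diffusionCLM hΩo hΩb (1 - 2 * s) hAlip hAsymm hell
  obtain ⟨Mc, hMcae, hMcsymm, hMcnonneg⟩ := exists_reactionCLM (1 - 2 * s) hcL hc0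
  obtain ⟨R, hR⟩ := hΩb.exists_norm_le
  -- The Poincaré constant is `K = 4 R²`, with `R` bounding the norm on `Ω`.
  obtain ⟨B, hBc, hBs, hB⟩ := exists_coercive_energyForm (energySpace Ω (1 - 2 * s))
    (one_div_pos.2 hd) (by positivity) hl (norm_fst_sq_le hn (by linarith) hR)
    hMAsymm hMAell hMcsymm hMcnonneg
  exact ⟨B, hBc, hBs, fun w φ => (form_eq_inner hMAae hMcae w φ).trans
    (hB (toEnergy Ω (1 - 2 * s) w) (toEnergy Ω (1 - 2 * s) φ)).symm⟩

/-! ### The admissible controls -/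

section Admissible

variable {n : ℕ} {Ω : Set (Sp n)}

/-- The pointwise bounds are the order of `Lp`, so closedness becomes that of an order interval. -/
theorem admissible_eq_Icc (a b : L2 Ω) : admissible a b = Set.Icc a b := by
  ext q
  simp only [admissible, Set.mem_ofPred_eq, Set.mem_Icc, eventually_and, ← Lp.coeFn_le,
    EventuallyLE]

theorem isClosed_admissible (a b : L2 Ω) : IsClosed (admissible a b) := by
  rw [admissible_eq_Icc]
  exact isClosed_Icc

theorem convex_admissible (a b : L2 Ω) : Convex ℝ (admissible a b) := by
  intro p hp q hq r t hr ht hrt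
  filter_upwards [hp, hq, Lp.coeFn_add (r • p) (t • q), Lp.coeFn_smul r p, Lp.coeFn_smul t q]
    with x hpx hqx h1 h2 h3
  rw [h1, Pi.add_apply, h2, h3]
  exact convex_Icc (a x) (b x) hpx hqx hr ht hrt

theorem left_mem_admissible {a b : L2 Ω}
    (hab : ∀ᵐ x ∂((volume : Measure (Sp n)).restrict Ω), a x ≤ b x) : a ∈ admissible a b := by
  filter_upwards [hab] with x hx
  exact ⟨le_rfl, hx⟩

end Admissible

end ExtendedControl

/-! ### Well-posedness and the optimality system. -/

theorem mainTheorem10 (n : ℕ) (hn : 1 ≤ n)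
    (Ω : Set (Sp n)) (hΩo : IsOpen Ω) (hΩb : Bornology.IsBounded Ω) (hΩc : IsConnected Ω)
    (s : ℝ) (hs0 : 0 < s) (hs1 : s < 1)
    (A : Sp n → Matrix (Fin n) (Fin n) ℝ)
    (hAlip : ∀ i j, ∃ K : NNReal, LipschitzOnWith K (fun x => A x i j) Ω)
    (hAsymm : ∀ x ∈ Ω, (A x).IsSymm)
    (hAell : ∃ l : ℝ, 0 < l ∧ ∀ x ∈ Ω, ∀ ξ : Sp n, l * ‖ξ‖ ^ 2 ≤ (A x *ᵥ ξ.ofLp) ⬝ᵥ ξ.ofLp)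
    (c : Sp n → ℝ) (hcL : MemLp c ∞ (volume.restrict Ω))
    (hc0 : ∀ᵐ x ∂((volume : Measure (Sp n)).restrict Ω), 0 ≤ c x)
    (a b : L2 Ω) (hab : ∀ᵐ x ∂((volume : Measure (Sp n)).restrict Ω), a x ≤ b x)
    (ud : L2 Ω) (μ : ℝ) (hμ : 0 < μ) :
    -- the trace, the state and the adjoint state are well defined
    (∀ w : HL Ω (1 - 2 * s), ∃! v : L2 Ω, IsTrace w v) ∧
    (∀ q : L2 Ω, ∃! u : HL Ω (1 - 2 * s), IsState s A c q u) ∧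
    (∀ u : HL Ω (1 - 2 * s), ∃! p : HL Ω (1 - 2 * s), IsAdjointState s A c ud u p) ∧
    -- existence and uniqueness of the optimal pair
    (∃! z : HL Ω (1 - 2 * s) × L2 Ω, IsOptimalPair s A c a b ud μ z.1 z.2) ∧
    -- the optimality system is necessary and sufficient
    (∀ (u : HL Ω (1 - 2 * s)) (q : L2 Ω),
      IsOptimalPair s A c a b ud μ u q ↔
        ∃ p : HL Ω (1 - 2 * s),
          IsState s A c q u ∧ IsAdjointState s A c ud u p ∧
          q ∈ admissible a b ∧
          ∀ q' ∈ admissible a b, 0 ≤ inner ℝ (tr p + μ • q) (q' - q)) := by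
  have hα : -1 < 1 - 2 * s := by linarith
  have hα1 : 1 - 2 * s < 1 := by linarith
  have := isFiniteMeasureOnCompacts_weightedMeasure Ω hα
  obtain ⟨B, hBc, hBs, hform⟩ := exists_coercive_form hn hΩo hΩb hs0 hs1 hAlip hAsymm hAell hcL hc0
  refine ⟨fun w => ⟨_, (isTrace_iff hα hα1 w _).2 rfl,
    fun v hv => (isTrace_iff hα hα1 w v).1 hv⟩, ?_⟩
  -- `IsState`, `IsAdjointState`, `cost` and `IsOptimalPair` unfold definitionally to the abstract
  -- conditions, with `tr` as `τ` and `form` as `β`.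
  exact linearQuadratic_control (toEnergy Ω (1 - 2 * s)) hBc hBs (traceEnergy Ω (1 - 2 * s))
    (tr_eq hα hα1) hform (convex_admissible a b) (isClosed_admissible a b)
    ⟨a, left_mem_admissible hab⟩ ud hμ
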